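/- Let $\lambda$ be a shape, i.e. a finite induced subgraph of the grid $\mathbb{Z}\times\mathbb{Z}$. A vertex $v$ of $\lambda$ is interior if $\lambda$ contains all $3\times 3$ vertices centered at $v$, and a boundary vertex otherwise. A path is a sequence $v_0,\dots,v_t$ ($t\ge 0$) of vertices of $\lambda$, each one step South or East of the previous one, with $v_0,v_t$ boundary vertices and $v_1,\dots,v_{t-1}$ interior vertices; a segment is a nonempty such sequence with all vertices interior. We write $p[v,v']$ for the part of $p$ from $v$ to $v'$, and $p[\cdot,v]$, $p[v,\cdot]$ for the parts of $p$ up to, respectively from, $v$. Two paths $p,q$ kiss along $s=p[v,v']=q[v,v']$ if one of them enters $v$ from the West and leaves $v'$ to the South while the other enters $v$ from the North and leaves $v'$ to the East. The non-kissing complex $\Delta^{NK}(\lambda)$ consists of the sets of pairwise non-kissing paths; the reduced complex $\widetilde\Delta^{NK}(\lambda)$ consists of those sets that contain no horizontal and no vertical path (paths with at most one vertex count as both). For facets $F_1,F_2$ of $\widetilde\Delta^{NK}(\lambda)$ with $F_1\setminus F_2=\{p_1\}$ and $F_2\setminus F_1=\{p_2\}$, there is an oriented flip $F_1\to F_2$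 if $p_1,p_2$ kiss along a segment that $p_1$ enters from the West (and $p_2$ from the North). Let $GT(\lambda)$ be the set of facets of $\widetilde\Delta^{NK}(\lambda)$ with the reflexive and transitive closure of the oriented flips. Let $S$ be the set of segments. For segments $s,t$ such that the last vertex of $s$ is one step North or West of the first vertex of $t$, let $s\circ t$ be their concatenation. A set $X\subseteq S$ is closed if $s,t\in X$ implies $s\circ t\in X$ whenever $s\circ t$ is a segment; it is biclosed if $X$ and $S\setminus X$ are closed. $\mathrm{Bic}(S)$ is the set of biclosed sets, ordered by inclusion. A subsegment $t$ of $s$ is a SW-subsegment if $t$ starts at the initial vertex of $s$ or $s$ enters $t$ from the North, and $t$ ends at the terminal vertex of $s$ or $s$ leaves $t$ to the East. Let $X^{\downarrow}$ be the set of $s\in X$ all of whose SW-subsegments are in $X$, and let $X\equiv Y \bmod \Theta$ if $X^{\downarrow}=Y^{\downarrow}$. For $X\in\mathrm{Bic}(S)$ and a vertical edge $e$ of $\lambda$ from $u$ down to $v$, let $p_e$ be the path containing $e$ such that for all interior vertices $u'$ of $p_e[\cdot,u]$ and $v'$ of $p_e[v,\cdot]$: $p_e$ enters $u'$ from the North if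 $p_e[u',u]\in X$ and from the West otherwise; $p_e$ leaves $v'$ to the East if $p_e[v,v']\in X$ and to the South otherwise. Let $\eta(X)$ be the set of all the paths $p_e$ together with all horizontal paths. Then for every shape $\lambda$: each $p_e$ exists and is unique; $\mathrm{Bic}(S)$ is a lattice and $\Theta$ is a lattice congruence on it; $\eta$ is a map from $\mathrm{Bic}(S)$ onto the set of facets of $\Delta^{NK}(\lambda)$, and its fibers are exactly the classes of $\Theta$; $GT(\lambda)$ is a partial order; and the map sending the class $[X]$ to $\eta(X)$ with its horizontal and vertical paths removed is a well-defined isomorphism of posets (hence of lattices) from the quotient lattice $\mathrm{Bic}(S)/\Theta$ onto $GT(\lambda)$, under which the cover relations of $\mathrm{Bic}(S)/\Theta$ correspond exactly to the oriented flips. In particular $GT(\lambda)$ is a lattice quotient of $\mathrm{Bic}(S)$. -/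

import Mathlib

namespace NonKissing

/-- Vertices of the square grid; `x.1` grows to the East and `x.2` grows to the North. -/
abbrev Vertex := ℤ × ℤ

/-- The vertex one step East of `v`. -/
def east (v : Vertex) : Vertex := (v.1 + 1, v.2)

/-- The vertex one step South of `v`. -/
def south (v : Vertex) : Vertex := (v.1, v.2 - 1)

/-- `v` is interior to the shape `lam` (a finite induced subgraph of the grid, given by its set of
vertices) if `lam` contains the grid of `2 × 2` cells, i.e. of `3 × 3` vertices, centered at `v`. -/
def IsInterior (lam : Finset Vertex) (v : Vertex) : Prop :=
  ∀ a b : ℤ, |a| ≤ 1 → |b| ≤ 1 → (v.1 + a, v.2 + b) ∈ lam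

/-- The vertices of the shape that are not interior. -/
def IsBoundary (lam : Finset Vertex) (v : Vertex) : Prop :=
  v ∈ lam ∧ ¬ IsInterior lam v

/-- A nonempty sequence of vertices, each one step South or East of the previous one. -/
def IsWalk (p : List Vertex) : Prop :=
  p ≠ [] ∧ p.IsChain (fun u v => v = east u ∨ v = south u)

/-- Paths supported by `lam`: walks `v₀, …, v_t` with `v₀` and `v_t` boundary vertices and
`v₁, …, v_{t-1}` interior vertices. -/
def IsPath (lam : Finset Vertex) (p : List Vertex) : Prop :=
  IsWalk p ∧ (∀ v ∈ p.head?, IsBoundary lam v) ∧ (∀ v ∈ p.getLast?, IsBoundary lam v) ∧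
    ∀ v ∈ p.tail.dropLast, IsInterior lam v

/-- Segments supported by `lam`: walks all of whose vertices are interior. -/
def IsSegment (lam : Finset Vertex) (s : List Vertex) : Prop :=
  IsWalk s ∧ ∀ v ∈ s, IsInterior lam v

/-- All steps of `p` go East. -/
def IsHorizontal (p : List Vertex) : Prop := p.IsChain (fun u v => v = east u)

/-- All steps of `p` go South. -/
def IsVertical (p : List Vertex) : Prop := p.IsChain (fun u v => v = south u)

/-- `s = p[v, v']`: the part of `p` from `v` to `v'`. -/
def IsPart (p : List Vertex) (v v' : Vertex) (s : List Vertex) : Prop :=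
  s <:+: p ∧ s.head? = some v ∧ s.getLast? = some v'

/-- `p` contains `s` and enters its initial vertex from the West. -/
def EntersWest (p s : List Vertex) : Prop :=
  ∃ w, s.head? = some (east w) ∧ (w :: s) <:+: p

/-- `p` contains `s` and enters its initial vertex from the North. -/
def EntersNorth (p s : List Vertex) : Prop :=
  ∃ w, s.head? = some (south w) ∧ (w :: s) <:+: p

/-- `p` contains `s` and leaves its terminal vertex to the East. -/
def LeavesEast (p s : List Vertex) : Prop :=
  ∃ w, s.getLast? = some w ∧ (s ++ [east w]) <:+: p

/-- `p` contains `s` and leaves its terminal vertex to the South. -/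
def LeavesSouth (p s : List Vertex) : Prop :=
  ∃ w, s.getLast? = some w ∧ (s ++ [south w]) <:+: p

/-- `p` and `q` agree along `s`, where `p` enters `s` from the West and leaves it to the South, and
`q` enters `s` from the North and leaves it to the East. -/
def KissAlong (s p q : List Vertex) : Prop :=
  EntersWest p s ∧ LeavesSouth p s ∧ EntersNorth q s ∧ LeavesEast q s

/-- The (unordered) pair of paths `p`, `q` is kissing. -/
def Kissing (p q : List Vertex) : Prop :=
  ∃ s, KissAlong s p q ∨ KissAlong s q p

/-! ### The non-kissing complex and the Grid-Tamari order -/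

/-- Faces of the non-kissing complex: sets of pairwise non-kissing paths. -/
def IsFace (lam : Finset Vertex) (F : Set (List Vertex)) : Prop :=
  (∀ p ∈ F, IsPath lam p) ∧ ∀ p ∈ F, ∀ q ∈ F, ¬ Kissing p q

/-- Facets of the non-kissing complex. -/
def Facet (lam : Finset Vertex) : Type :=
  {F : Set (List Vertex) // Maximal (IsFace lam) F}

/-- Faces of the reduced non-kissing complex: those without horizontal and vertical paths. -/
def IsReducedFace (lam : Finset Vertex) (F : Set (List Vertex)) : Prop :=
  IsFace lam F ∧ ∀ p ∈ F, ¬ IsHorizontal p ∧ ¬ IsVertical p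

/-- The elements of the Grid-Tamari order: facets of the reduced non-kissing complex. -/
def GridTamari (lam : Finset Vertex) : Type :=
  {F : Set (List Vertex) // Maximal (IsReducedFace lam) F}

/-- The oriented flip `F₁ → F₂`: the facets `F₁` and `F₂` are adjacent, `F₁ \ F₂ = {p₁}`,
`F₂ \ F₁ = {p₂}`, and `p₁`, `p₂` kiss along a segment that `p₁` enters from the West. -/
def Flip (F₁ F₂ : Set (List Vertex)) : Prop :=
  ∃ p₁ p₂, F₁ \ F₂ = {p₁} ∧ F₂ \ F₁ = {p₂} ∧ ∃ s, KissAlong s p₁ p₂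

/-- The (reflexive and) transitive closure of the oriented flips. -/
def GTLe {lam : Finset Vertex} : GridTamari lam → GridTamari lam → Prop :=
  Relation.ReflTransGen fun F G => Flip F.1 G.1

/-! ### Biclosed sets of segments -/

/-- A set of segments is closed if it contains the composite `s ∘ t` of any two of its elements for
which this composite is a segment. -/
def IsClosedSet (lam : Finset Vertex) (X : Set (List Vertex)) : Prop :=
  ∀ s ∈ X, ∀ t ∈ X, IsSegment lam (s ++ t) → s ++ t ∈ X

/-- A set of segments is biclosed if it is closed and its complement, among all segments, is. -/
def IsBiclosed (lam : Finset Vertex) (X : Set (List Vertex)) : Prop :=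
  X ⊆ {s | IsSegment lam s} ∧ IsClosedSet lam X ∧ IsClosedSet lam ({s | IsSegment lam s} \ X)

/-- The biclosed sets of segments of `lam`. -/
def Bic (lam : Finset Vertex) : Type :=
  {X : Set (List Vertex) // IsBiclosed lam X}

/-- `t` is a SW-subsegment of `s`: `s` enters `t` from the North unless `t` starts where `s` does,
and `s` leaves `t` to the East unless `t` ends where `s` does. -/
def IsSWSubsegment (t s : List Vertex) : Prop :=
  t ≠ [] ∧ t <:+: s ∧ (t <+: s ∨ EntersNorth s t) ∧ (t <:+ s ∨ LeavesEast s t)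

/-- `X↓`: the segments in `X` all of whose SW-subsegments are in `X`. -/
def down (X : Set (List Vertex)) : Set (List Vertex) :=
  {s ∈ X | ∀ t, IsSWSubsegment t s → t ∈ X}

/-! ### The map `η` -/

/-- There is a vertical edge of `lam` from `u` down to `south u`. -/
def IsVerticalEdge (lam : Finset Vertex) (u : Vertex) : Prop :=
  u ∈ lam ∧ south u ∈ lam

/-- `p` is the path `p_e` defined by the set `X` of segments and the vertical edge `e` from `u` to
`v = south u`: it contains `e`, it enters an interior vertex `u'` of `p[·, u]` from the North or the
West according to whether `p[u', u]` is in `X` or not, and it leaves an interior vertex `v'` of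
`p[v, ·]` to the East or the South according to whether `p[v, v']` is in `X` or not. -/
structure IsEtaPath (lam : Finset Vertex) (X : Set (List Vertex)) (u : Vertex)
    (p : List Vertex) : Prop where
  isPath : IsPath lam p
  edge : [u, south u] <:+: p
  enters : ∀ u' s, IsInterior lam u' → IsPart p u' u s →
    (s ∈ X → EntersNorth p s) ∧ (s ∉ X → EntersWest p s)
  leaves : ∀ v' s, IsInterior lam v' → IsPart p (south u) v' s →
    (s ∈ X → LeavesEast p s) ∧ (s ∉ X → LeavesSouth p s)

/-- `η(X)`: the paths `p_e` for all vertical edges `e`, and all horizontal paths. -/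
def eta (lam : Finset Vertex) (X : Set (List Vertex)) : Set (List Vertex) :=
  {p | ∃ u, IsVerticalEdge lam u ∧ IsEtaPath lam X u p} ∪ {p | IsPath lam p ∧ IsHorizontal p}

/-! ### Quotient lattices -/

/-- The set of classes of a lattice congruence. -/
def LatticeQuotient {α : Type*} [Lattice α] (c : LatticeCon α) : Type _ :=
  Quotient c.toSetoid

/-- The class `[x]` of `x`. -/
def cls {α : Type*} [Lattice α] (c : LatticeCon α) (x : α) : LatticeQuotient c :=
  Quotient.mk c.toSetoid x

/-- The lattice structure on the classes, with `[x] ⊔ [y] = [x ⊔ y]` and `[x] ⊓ [y] = [x ⊓ y]`. -/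
instance {α : Type*} [Lattice α] (c : LatticeCon α) : Lattice (LatticeQuotient c) :=
  letI : Max (LatticeQuotient c) :=
    ⟨Quotient.map₂ (· ⊔ ·) fun _ _ h _ _ h' => c.sup h h'⟩
  letI : Min (LatticeQuotient c) :=
    ⟨Quotient.map₂ (· ⊓ ·) fun _ _ h _ _ h' => c.inf h h'⟩
  Lattice.mk'
    (by rintro ⟨a⟩ ⟨b⟩; exact congrArg (cls c) (sup_comm a b))
    (by rintro ⟨a⟩ ⟨b⟩ ⟨d⟩; exact congrArg (cls c) (sup_assoc a b d))
    (by rintro ⟨a⟩ ⟨b⟩; exact congrArg (cls c) (inf_comm a b))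
    (by rintro ⟨a⟩ ⟨b⟩ ⟨d⟩; exact congrArg (cls c) (inf_assoc a b d))
    (by rintro ⟨a⟩ ⟨b⟩; exact congrArg (cls c) (sup_inf_self (a := a) (b := b)))
    (by rintro ⟨a⟩ ⟨b⟩; exact congrArg (cls c) (inf_sup_self (a := a) (b := b)))

end NonKissing

open NonKissing

namespace NonKissing

/-! Number each edge of a path `p` by the position of its terminal vertex, starting at 1, so that
`sl p i j` is the segment between the edges `i < j`. A biclosed set X is then the inversion set of a
total order on the edges of `p` (`EdgeLt`, `EdgeLt.trans`). In these terms p_e is the path on which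
the other horizontal edges precede e and the other vertical edges follow it (`IsCut`), and a path is
in η(X) iff its horizontal edges all precede its vertical edges (`mem_eta_iff`). Equivalently, the
segments that it enters from the North and leaves to the East are in X, and those that it enters
from the West and leaves to the South are not (`mem_eta_iff_bends`). Kissing paths share a segment
that is a bend of both kinds, so η(X) is a face; it is a facet by `mem_eta_of_not_kissing`.

For a face F, the closures of the two kinds of bends are biclosed. They give bounds `lo` and `hi`
such that F ⊆ η(X) iff `lo` F ⊆ X ⊆ `hi` F (`subset_eta_iff`), so the fiber of η over a facet is a
nonempty interval. By `subs_subset_of_mem_cl` and `mem_cl_of_subs_subset`, the lower end of the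
fiber of X is X↓, and the upper end has the dual description. Hence both ends are monotone in X,
which makes the fibers the classes of a lattice congruence.

Deleting one segment from a biclosed set reverses at most one pair of edges on a path, so it changes
η by at most one flip (`flip_eta_diff_singleton`). Between nested biclosed sets such a deletion is
always possible (`exists_isBiclosed_diff`), so flips generate the quotient order. Conversely, a face
of codimension one shares `lo` or `hi` with its facet (`lo_eq_or_hi_eq`), which forces every flip to
go up and to be a cover (`Flip.down_lt`). Horizontal and vertical paths have no bends and lie in
every η(X), so nothing is lost by removing them. -/

/-! ### Positions, directions and slices of lists -/

/-- The `i`-th vertex of a list. -/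
def vx (p : List Vertex) (i : ℕ) : Vertex := p.getD i (0, 0)

/-- One step South (`true`) or East (`false`). -/
def stp (d : Bool) (v : Vertex) : Vertex := if d then south v else east v

/-- One step back. -/
def prv (d : Bool) (v : Vertex) : Vertex := if d then (v.1, v.2 + 1) else (v.1 - 1, v.2)

/-- The direction of the step entering the `i`-th vertex: `true` for South. -/
def dir (p : List Vertex) (i : ℕ) : Bool := decide (vx p i = south (vx p (i - 1)))

/-- The part of `p` between the positions `i` (included) and `j` (excluded). -/
def sl (p : List Vertex) (i j : ℕ) : List Vertex := (p.take j).drop i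

theorem stp_prv (d : Bool) (v : Vertex) : stp d (prv d v) = v := by
  cases d <;> simp [stp, prv, south, east]

theorem stp_injective (d : Bool) {v w : Vertex} (h : stp d v = stp d w) : v = w := by
  cases d <;> simp [stp, south, east, Prod.ext_iff] at h ⊢ <;> omega

theorem prv_stp (d : Bool) (v : Vertex) : prv d (stp d v) = v :=
  stp_injective d (stp_prv d _)

theorem stp_eq_south {d : Bool} {v : Vertex} : stp d v = south v ↔ d = true := by
  cases d <;> simp [stp, south, east, Prod.ext_iff]

theorem vx_eq_getElem {p : List Vertex} {i : ℕ} (h : i < p.length) : vx p i = p[i] := by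
  simp [vx, List.getD, h]

theorem length_sl {p : List Vertex} {i j : ℕ} (hj : j ≤ p.length) :
    (sl p i j).length = j - i := by
  simp [sl, hj]

theorem vx_sl {p : List Vertex} {i j a : ℕ} (h : i + a < j) : vx (sl p i j) a = vx p (i + a) := by
  simp [vx, sl, List.getD, h]

theorem sl_sl {p : List Vertex} {i j a b : ℕ} (h : i + b ≤ j) :
    sl (sl p i j) a b = sl p (i + a) (i + b) := by
  apply List.ext_getElem?
  intro n
  simp only [sl, List.getElem?_drop, List.getElem?_take]
  by_cases h1 : a + n < b
  · rw [if_pos h1, if_pos (by omega), if_pos (by omega)]; congr 1; omega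
  · rw [if_neg h1, if_neg (by omega)]

theorem sl_append {p : List Vertex} {i j k : ℕ} (hij : i ≤ j) (hjk : j ≤ k) :
    sl p i j ++ sl p j k = sl p i k := by
  have h1 : sl p i j = ((p.take k).drop i).take (j - i) := by
    simp only [sl, List.take_drop, List.take_take]
    congr 2; omega
  have h2 : sl p j k = ((p.take k).drop i).drop (j - i) := by
    simp only [sl, List.drop_drop]
    congr 1; omega
  rw [h1, h2, List.take_append_drop]; rfl

theorem dir_sl {p : List Vertex} {i j a : ℕ} (ha : 1 ≤ a) (h : i + a < j) :
    dir (sl p i j) a = dir p (i + a) := by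
  simp only [dir]
  rw [vx_sl h, vx_sl (by omega), show i + a - 1 = i + (a - 1) by omega]

theorem sl_length (p : List Vertex) : sl p 0 p.length = p := by simp [sl]

theorem sl_append_left {x y : List Vertex} {i j : ℕ} (h : j ≤ x.length) :
    sl (x ++ y) i j = sl x i j := by
  simp [sl, List.take_append_of_le_length h]

theorem sl_append_right {x y : List Vertex} {i j : ℕ} :
    sl (x ++ y) (x.length + i) (x.length + j) = sl y i j := by
  simp [sl, List.take_append, List.drop_append]

theorem vx_append_left {x y : List Vertex} {i : ℕ} (h : i < x.length) :
    vx (x ++ y) i = vx x i := by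
  simp [vx, List.getD, List.getElem?_append_left h]

theorem vx_append_right {x y : List Vertex} {i : ℕ} : vx (x ++ y) (x.length + i) = vx y i := by
  simp [vx, List.getD, List.getElem?_append_right]

theorem dir_append_left {x y : List Vertex} {i : ℕ} (h : i < x.length) :
    dir (x ++ y) i = dir x i := by
  simp only [dir]; rw [vx_append_left h, vx_append_left (by omega)]

theorem dir_append_right {x y : List Vertex} {i : ℕ} (h : 1 ≤ i) :
    dir (x ++ y) (x.length + i) = dir y i := by
  simp only [dir]
  rw [vx_append_right, show x.length + i - 1 = x.length + (i - 1) by omega, vx_append_right]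

theorem infix_iff_sl {s p : List Vertex} :
    s <:+: p ↔ ∃ i j, i ≤ j ∧ j ≤ p.length ∧ s = sl p i j := by
  constructor
  · rintro ⟨a, b, rfl⟩
    refine ⟨a.length, a.length + s.length, by omega, by simp, ?_⟩
    rw [sl_append_left (by simp), show a.length = a.length + 0 from rfl, Nat.add_assoc, Nat.zero_add,
      sl_append_right, sl_length]
  · rintro ⟨i, j, -, -, rfl⟩
    exact (List.drop_suffix _ _).isInfix.trans (List.take_prefix _ _).isInfix

theorem ext_vx {p q : List Vertex} (hl : p.length = q.length)
    (h : ∀ i < p.length, vx p i = vx q i) : p = q := by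
  apply List.ext_getElem hl
  intro i h1 h2
  rw [← vx_eq_getElem h1, ← vx_eq_getElem h2, h i h1]

theorem head?_eq_vx {p : List Vertex} (h : p ≠ []) : p.head? = some (vx p 0) := by
  cases p with
  | nil => exact absurd rfl h
  | cons a l => simp [vx]

theorem getLast?_eq_vx {p : List Vertex} (h : p ≠ []) :
    p.getLast? = some (vx p (p.length - 1)) := by
  have := List.length_pos_iff.mpr h
  rw [List.getLast?_eq_getElem?, vx_eq_getElem (by omega), List.getElem?_eq_getElem]

theorem mem_iff_vx {p : List Vertex} {v : Vertex} : v ∈ p ↔ ∃ i < p.length, vx p i = v := by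
  rw [List.mem_iff_getElem]
  constructor
  · rintro ⟨i, h, rfl⟩; exact ⟨i, h, vx_eq_getElem h⟩
  · rintro ⟨i, h, rfl⟩; exact ⟨i, h, (vx_eq_getElem h).symm⟩

theorem mem_tail_dropLast {p : List Vertex} {v : Vertex} :
    v ∈ p.tail.dropLast ↔ ∃ i, 1 ≤ i ∧ i + 1 < p.length ∧ vx p i = v := by
  rw [List.mem_iff_getElem]
  constructor
  · rintro ⟨i, h, rfl⟩
    simp at h
    refine ⟨i + 1, by omega, by omega, ?_⟩
    rw [vx_eq_getElem (by omega)]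
    simp
  · rintro ⟨i, h1, h2, rfl⟩
    refine ⟨i - 1, by simp; omega, ?_⟩
    rw [vx_eq_getElem (by omega)]
    simp [show i - 1 + 1 = i by omega]

/-! ### Walks never revisit a vertex -/

/-- The quantity that grows by one along each step of a walk. -/
def pot (v : Vertex) : ℤ := v.1 - v.2

theorem pot_stp (d : Bool) (v : Vertex) : pot (stp d v) = pot v + 1 := by
  cases d <;> simp [pot, stp, south, east] <;> ring

theorem isWalk_iff {p : List Vertex} :
    IsWalk p ↔ p ≠ [] ∧ ∀ i, 1 ≤ i → i < p.length → vx p i = stp (dir p i) (vx p (i - 1)) := by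
  unfold IsWalk
  refine and_congr_right fun _ => ?_
  rw [List.isChain_iff_getElem]
  constructor
  · intro h i h1 h2
    have := h (i - 1) (by omega)
    rw [← vx_eq_getElem, ← vx_eq_getElem, show i - 1 + 1 = i by omega] at this
    by_cases hs : vx p i = south (vx p (i - 1))
    · simp [dir, stp, hs]
    · simp [dir, stp, hs]; tauto
  · intro h i hi
    have := h (i + 1) (by omega) hi
    rw [vx_eq_getElem hi, show i + 1 - 1 = i from rfl, vx_eq_getElem (by omega)] at this
    rw [this]
    cases dir p (i + 1) <;> simp [stp]

theorem IsWalk.vx_succ {p : List Vertex} (hp : IsWalk p) {i : ℕ} (h1 : 1 ≤ i) (h2 : i < p.length) :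
    vx p i = stp (dir p i) (vx p (i - 1)) := (isWalk_iff.mp hp).2 i h1 h2

theorem IsWalk.dir_eq {p : List Vertex} (hp : IsWalk p) {i : ℕ} {d : Bool} (h1 : 1 ≤ i)
    (h2 : i < p.length) : dir p i = d ↔ vx p i = stp d (vx p (i - 1)) := by
  have := hp.vx_succ h1 h2
  constructor
  · rintro rfl; exact this
  · intro h
    rw [h] at this
    cases h3 : dir p i <;> cases d <;> simp [h3, stp, south, east, Prod.ext_iff] at this ⊢

theorem IsWalk.pot_vx {p : List Vertex} (hp : IsWalk p) {i : ℕ} (h : i < p.length) :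
    pot (vx p i) = pot (vx p 0) + i := by
  induction i with
  | zero => simp
  | succ n ih =>
    rw [hp.vx_succ (by omega) h, pot_stp, Nat.add_sub_cancel, ih (by omega)]
    push_cast; ring

theorem IsWalk.vx_injective {p : List Vertex} (hp : IsWalk p) {i j : ℕ} (hi : i < p.length)
    (hj : j < p.length) (h : vx p i = vx p j) : i = j := by
  have := hp.pot_vx hi
  rw [h, hp.pot_vx hj] at this
  omega

/-- The first vertex of a slice occurs only once in a walk, so it fixes the starting position, and
the length fixes the end. This is why a segment of a path may be identified with a pair of edges. -/
theorem IsWalk.sl_injective {p : List Vertex} (hp : IsWalk p) {i j a b : ℕ} (hij : i < j)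
    (hj : j ≤ p.length) (hab : a < b) (hb : b ≤ p.length) (h : sl p i j = sl p a b) :
    i = a ∧ j = b := by
  have h1 := congrArg List.length h
  rw [length_sl hj, length_sl hb] at h1
  have h2 := congrArg (fun l => vx l 0) h
  rw [vx_sl (by omega), vx_sl (by omega)] at h2
  have := hp.vx_injective (by omega) (by omega) h2
  omega

theorem IsWalk.part {p : List Vertex} (hp : IsWalk p) {i j : ℕ} (hij : i < j) (hj : j ≤ p.length) :
    IsWalk (sl p i j) := by
  refine ⟨fun h => ?_, hp.2.infix (infix_iff_sl.mpr ⟨i, j, by omega, hj, rfl⟩)⟩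
  have := congrArg List.length h
  rw [length_sl hj] at this
  simp at this
  omega

theorem IsWalk.nodup {p : List Vertex} (hp : IsWalk p) : p.Nodup := by
  rw [List.nodup_iff_injective_get]
  intro i j h
  rw [List.get_eq_getElem, List.get_eq_getElem] at h
  rw [← vx_eq_getElem, ← vx_eq_getElem] at h
  exact Fin.ext (hp.vx_injective i.2 j.2 h)

/-! ### Tracks -/

/-- Walks in `lam` whose inner vertices are interior. -/
def IsTrack (lam : Finset Vertex) (p : List Vertex) : Prop :=
  IsWalk p ∧ (∀ v ∈ p, v ∈ lam) ∧ ∀ i, 1 ≤ i → i + 1 < p.length → IsInterior lam (vx p i)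

theorem IsInterior.mem {lam : Finset Vertex} {v : Vertex} (h : IsInterior lam v) : v ∈ lam := by
  simpa using h 0 0 (by simp) (by simp)

theorem IsInterior.stp_mem {lam : Finset Vertex} {v : Vertex} (h : IsInterior lam v) (d : Bool) :
    stp d v ∈ lam := by
  cases d
  · simpa [stp, east] using h 1 0 (by simp) (by simp)
  · simpa [stp, south, sub_eq_add_neg] using h 0 (-1) (by simp) (by simp)

theorem IsInterior.prv_mem {lam : Finset Vertex} {v : Vertex} (h : IsInterior lam v) (d : Bool) :
    prv d v ∈ lam := by
  cases d
  · simpa [prv, sub_eq_add_neg] using h (-1) 0 (by simp) (by simp)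
  · simpa [prv] using h 0 1 (by simp) (by simp)

theorem isPath_iff {lam : Finset Vertex} {p : List Vertex} :
    IsPath lam p ↔ IsTrack lam p ∧ ¬ IsInterior lam (vx p 0) ∧
      ¬ IsInterior lam (vx p (p.length - 1)) := by
  constructor
  · rintro ⟨hw, h0, h1, h2⟩
    rw [head?_eq_vx hw.1] at h0
    rw [getLast?_eq_vx hw.1] at h1
    have h0 := h0 _ rfl
    have h1 := h1 _ rfl
    have h2' : ∀ i, 1 ≤ i → i + 1 < p.length → IsInterior lam (vx p i) := fun i hi hi' =>
      h2 _ (mem_tail_dropLast.mpr ⟨i, hi, hi', rfl⟩)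
    refine ⟨⟨hw, ?_, h2'⟩, h0.2, h1.2⟩
    intro v hv
    obtain ⟨i, hi, rfl⟩ := mem_iff_vx.mp hv
    rcases Nat.eq_zero_or_pos i with rfl | hpos
    · exact h0.1
    · by_cases hl : i + 1 < p.length
      · exact (h2' i hpos hl).mem
      · rw [show i = p.length - 1 by omega]; exact h1.1
  · rintro ⟨⟨hw, hm, hi⟩, h0, h1⟩
    have hpos := List.length_pos_iff.mpr hw.1
    refine ⟨hw, ?_, ?_, ?_⟩
    · rw [head?_eq_vx hw.1]
      rintro v ⟨⟩
      exact ⟨hm _ (mem_iff_vx.mpr ⟨0, hpos, rfl⟩), h0⟩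
    · rw [getLast?_eq_vx hw.1]
      rintro v ⟨⟩
      exact ⟨hm _ (mem_iff_vx.mpr ⟨_, by omega, rfl⟩), h1⟩
    · intro v hv
      obtain ⟨i, h1, h2, rfl⟩ := mem_tail_dropLast.mp hv
      exact hi i h1 h2

theorem IsPath.track {lam : Finset Vertex} {p : List Vertex} (h : IsPath lam p) : IsTrack lam p :=
  (isPath_iff.mp h).1

theorem IsTrack.isSegment {lam : Finset Vertex} {p : List Vertex} (hp : IsTrack lam p) {i j : ℕ}
    (hi : 1 ≤ i) (hij : i < j) (hj : j < p.length) : IsSegment lam (sl p i j) := by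
  refine ⟨hp.1.part hij hj.le, fun v hv => ?_⟩
  obtain ⟨a, ha, rfl⟩ := mem_iff_vx.mp hv
  rw [length_sl hj.le] at ha
  rw [vx_sl (by omega)]
  exact hp.2.2 _ (by omega) (by omega)

theorem IsSegment.part {lam : Finset Vertex} {s : List Vertex} (hs : IsSegment lam s) {i j : ℕ}
    (hij : i < j) (hj : j ≤ s.length) : IsSegment lam (sl s i j) := by
  refine ⟨hs.1.part hij hj, fun v hv => hs.2 v ?_⟩
  exact (infix_iff_sl.mpr ⟨i, j, hij.le, hj, rfl⟩).subset hv

theorem IsSegment.append_left {lam : Finset Vertex} {s t : List Vertex}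
    (h : IsSegment lam (s ++ t)) (hs : s ≠ []) : IsSegment lam s :=
  ⟨⟨hs, h.1.2.left_of_append⟩, fun v hv => h.2 v (by simp [hv])⟩

theorem IsSegment.append_right {lam : Finset Vertex} {s t : List Vertex}
    (h : IsSegment lam (s ++ t)) (ht : t ≠ []) : IsSegment lam t :=
  ⟨⟨ht, h.1.2.right_of_append⟩, fun v hv => h.2 v (by simp [hv])⟩

theorem IsSegment.length_pos {lam : Finset Vertex} {s : List Vertex} (h : IsSegment lam s) :
    0 < s.length := List.length_pos_iff.mpr h.1.1

theorem IsTrack.length_le {lam : Finset Vertex} {p : List Vertex} (hp : IsTrack lam p) :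
    p.length ≤ lam.card := by
  rw [← List.toFinset_card_of_nodup hp.1.nodup]
  exact Finset.card_le_card fun v hv => hp.2.1 v (by simpa using hv)

theorem finite_segments (lam : Finset Vertex) : {s | IsSegment lam s}.Finite := by
  have h := (List.finite_length_le lam lam.card).image (List.map Subtype.val)
  refine h.subset fun s hs => ?_
  refine ⟨s.attach.map fun v => ⟨v.1, (hs.2 v.1 v.2).mem⟩, ?_, ?_⟩
  · simp only [Set.mem_ofPred_eq, List.length_map, List.length_attach]
    rw [← List.toFinset_card_of_nodup hs.1.nodup]
    exact Finset.card_le_card fun v hv => (hs.2 v (by simpa using hv)).mem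
  · rw [List.map_map]
    exact List.attach_map_subtype_val s

/-! ### Biclosed sets -/

/-- `X` itself for `d = true`, and its complement among the segments for `d = false`. -/
def sgn (lam : Finset Vertex) (d : Bool) (X : Set (List Vertex)) : Set (List Vertex) :=
  if d then X else {s | IsSegment lam s} \ X

theorem mem_sgn {lam : Finset Vertex} {d : Bool} {X : Set (List Vertex)} {s : List Vertex}
    (hs : IsSegment lam s) : s ∈ sgn lam d X ↔ (s ∈ X ↔ d = true) := by
  cases d <;> simp [sgn, hs]

theorem IsBiclosed.compl {lam : Finset Vertex} {X : Set (List Vertex)} (hX : IsBiclosed lam X) :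
    IsBiclosed lam ({s | IsSegment lam s} \ X) := by
  refine ⟨Set.sdiff_subset, hX.2.2, ?_⟩
  rw [Set.sdiff_sdiff_cancel_left hX.1]
  exact hX.2.1

/-- Complementation exchanges the roles of South and East; the sign `d` lets one argument serve for
both. -/
theorem IsBiclosed.signed {lam : Finset Vertex} {X : Set (List Vertex)} (hX : IsBiclosed lam X)
    (d : Bool) : IsBiclosed lam (sgn lam d X) := by
  cases d
  · exact hX.compl
  · exact hX

theorem IsBiclosed.split {lam : Finset Vertex} {X : Set (List Vertex)} (hX : IsBiclosed lam X)
    {s t : List Vertex} (hs : s ≠ []) (ht : t ≠ []) (h : s ++ t ∈ X) : s ∈ X ∨ t ∈ X := by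
  have hst : IsSegment lam (s ++ t) := hX.1 h
  by_contra hc
  push Not at hc
  exact (hX.2.2 s ⟨hst.append_left hs, hc.1⟩ t ⟨hst.append_right ht, hc.2⟩ hst).2 h

theorem sgn_not {lam : Finset Vertex} {X : Set (List Vertex)} {d : Bool} {s : List Vertex}
    (hs : IsSegment lam s) : s ∈ sgn lam (!d) X ↔ s ∉ sgn lam d X := by
  rw [mem_sgn hs, mem_sgn hs]
  cases d <;> simp

theorem sl_ne_nil {p : List Vertex} {i j : ℕ} (hij : i < j) (hj : j ≤ p.length) : sl p i j ≠ [] := by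
  rw [← List.length_pos_iff, length_sl hj]; omega

theorem IsBiclosed.sl_trans {lam : Finset Vertex} {X : Set (List Vertex)} (hX : IsBiclosed lam X)
    {p : List Vertex} {i j k : ℕ} (hij : i < j) (hjk : j < k) (hp : IsSegment lam (sl p i k))
    (h1 : sl p i j ∈ X) (h2 : sl p j k ∈ X) : sl p i k ∈ X := by
  have := hX.2.1 _ h1 _ h2
  rw [sl_append hij.le hjk.le] at this
  exact this hp

theorem IsBiclosed.sl_split {lam : Finset Vertex} {X : Set (List Vertex)} (hX : IsBiclosed lam X)
    {p : List Vertex} {i j k : ℕ} (hij : i < j) (hjk : j < k) (hk : k ≤ p.length)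
    (h : sl p i k ∈ X) : sl p i j ∈ X ∨ sl p j k ∈ X := by
  apply hX.split (sl_ne_nil hij (by omega)) (sl_ne_nil hjk hk)
  rwa [sl_append hij.le hjk.le]

/-! ### The order of the edges of a track -/

/-- The order on the edges of `p` given by `X`. The edges are numbered by their terminal vertices,
and `X` consists of the inversions. -/
def EdgeLt (X : Set (List Vertex)) (p : List Vertex) (i j : ℕ) : Prop :=
  (i < j ∧ sl p i j ∉ X) ∨ (j < i ∧ sl p j i ∈ X)

theorem EdgeLt.of_lt {X : Set (List Vertex)} {p : List Vertex} {i j : ℕ} (h : i < j) :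
    EdgeLt X p i j ↔ sl p i j ∉ X := by
  simp [EdgeLt, h, h.not_gt]

theorem EdgeLt.of_gt {X : Set (List Vertex)} {p : List Vertex} {i j : ℕ} (h : j < i) :
    EdgeLt X p i j ↔ sl p j i ∈ X := by
  simp [EdgeLt, h, h.not_gt]

theorem not_edgeLt {X : Set (List Vertex)} {p : List Vertex} {i j : ℕ} (h : i ≠ j) :
    ¬ EdgeLt X p i j ↔ EdgeLt X p j i := by
  rcases h.lt_or_gt with h | h
  · rw [EdgeLt.of_lt h, EdgeLt.of_gt h, not_not]
  · rw [EdgeLt.of_lt h, EdgeLt.of_gt h]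

theorem EdgeLt.ne {X : Set (List Vertex)} {p : List Vertex} {i j : ℕ} (h : EdgeLt X p i j) :
    i ≠ j := by
  rintro rfl
  simp [EdgeLt] at h

theorem EdgeLt.asymm {X : Set (List Vertex)} {p : List Vertex} {i j : ℕ} (h : EdgeLt X p i j) :
    ¬ EdgeLt X p j i := by
  rwa [not_edgeLt h.ne.symm]

/-- Among three positions a < b < c, closedness of X (`T`) and of its complement (`C`) exclude
exactly the two cyclic patterns. -/
theorem EdgeLt.trans {lam : Finset Vertex} {X : Set (List Vertex)} {p : List Vertex} {i j k : ℕ}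
    (hX : IsBiclosed lam X) (hp : IsTrack lam p) (hi : 1 ≤ i ∧ i < p.length)
    (hj : 1 ≤ j ∧ j < p.length) (hk : 1 ≤ k ∧ k < p.length)
    (h1 : EdgeLt X p i j) (h2 : EdgeLt X p j k) : EdgeLt X p i k := by
  have T : ∀ {a b c}, 1 ≤ a → a < b → b < c → c < p.length → sl p a b ∈ X → sl p b c ∈ X →
      sl p a c ∈ X := fun ha hab hbc hc => hX.sl_trans hab hbc (hp.isSegment ha (hab.trans hbc) hc)
  have C : ∀ {a b c}, 1 ≤ a → a < b → b < c → c < p.length → sl p a c ∈ X →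
      sl p a b ∈ X ∨ sl p b c ∈ X := fun ha hab hbc hc => hX.sl_split hab hbc hc.le
  rcases h1 with ⟨hij, h1⟩ | ⟨hij, h1⟩ <;> rcases h2 with ⟨hjk, h2⟩ | ⟨hjk, h2⟩
  · exact (EdgeLt.of_lt (hij.trans hjk)).mpr fun h => (C hi.1 hij hjk hk.2 h).elim h1 h2
  · rcases lt_trichotomy i k with h | rfl | h
    · exact (EdgeLt.of_lt h).mpr fun h' => h1 (T hi.1 h hjk hj.2 h' h2)
    · exact absurd h2 h1
    · exact (EdgeLt.of_gt h).mpr ((C hk.1 h hij hj.2 h2).resolve_right h1)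
  · rcases lt_trichotomy i k with h | rfl | h
    · exact (EdgeLt.of_lt h).mpr fun h' => h2 (T hj.1 hij h hk.2 h1 h')
    · exact absurd h1 h2
    · exact (EdgeLt.of_gt h).mpr ((C hj.1 hjk h hi.2 h1).resolve_left h2)
  · exact (EdgeLt.of_gt (hjk.trans hij)).mpr (T hk.1 hjk hij hi.2 h2 h1)

/-- In the order given by `X`, the horizontal edges of `p` come before the vertical edges. -/
def IsCompat (X : Set (List Vertex)) (p : List Vertex) : Prop :=
  ∀ i j, 1 ≤ i ∧ i < p.length → 1 ≤ j ∧ j < p.length → dir p i = false → dir p j = true →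
    EdgeLt X p i j

/-- In the order given by `X`, the edge `i` separates the other horizontal edges of `p` from the
other vertical edges. -/
def IsCut (X : Set (List Vertex)) (p : List Vertex) (i : ℕ) : Prop :=
  ∀ k, 1 ≤ k ∧ k < p.length → k ≠ i → (dir p k = false ↔ EdgeLt X p k i)

theorem IsCut.isCompat {lam : Finset Vertex} {X : Set (List Vertex)} {p : List Vertex} {i : ℕ}
    (hX : IsBiclosed lam X) (hp : IsTrack lam p) (hi : 1 ≤ i ∧ i < p.length) (h : IsCut X p i) :
    IsCompat X p := by
  intro a b ha hb hda hdb
  have h1 : a ≠ i → EdgeLt X p a i := fun hne => (h a ha hne).mp hda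
  have h2 : b ≠ i → EdgeLt X p i b := fun hne => by
    rw [← not_edgeLt hne, ← h b hb hne, hdb]; simp
  by_cases hai : a = i
  · subst hai
    exact h2 (by rintro rfl; simp [hda] at hdb)
  · by_cases hbi : b = i
    · subst hbi; exact h1 hai
    · exact EdgeLt.trans hX hp ha hi hb (h1 hai) (h2 hbi)

theorem exists_edge_min {lam : Finset Vertex} {X : Set (List Vertex)} {p : List Vertex}
    (hX : IsBiclosed lam X) (hp : IsTrack lam p) (A : Finset ℕ) (hne : A.Nonempty)
    (hA : ∀ i ∈ A, 1 ≤ i ∧ i < p.length) : ∃ i ∈ A, ∀ j ∈ A, j ≠ i → EdgeLt X p i j := by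
  induction hne using Finset.Nonempty.cons_induction with
  | singleton a => exact ⟨a, by simp, by simp⟩
  | cons a B ha hB ih =>
    obtain ⟨i, hi, hmin⟩ := ih fun i hi => hA i (by simp [hi])
    have hne : a ≠ i := by rintro rfl; exact ha hi
    by_cases h : EdgeLt X p a i
    · refine ⟨a, by simp, fun j hj hja => ?_⟩
      rcases Finset.mem_cons.mp hj with rfl | hj'
      · exact absurd rfl hja
      · by_cases hji : j = i
        · rwa [hji]
        · exact EdgeLt.trans hX hp (hA a (by simp)) (hA i (by simp [hi])) (hA j hj) h
            (hmin j hj' hji)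
    · refine ⟨i, by simp [hi], fun j hj hji => ?_⟩
      rcases Finset.mem_cons.mp hj with rfl | hj'
      · exact (not_edgeLt hne).mp h
      · exact hmin j hj' hji

/-- The least vertical edge is a cut. Every compatible path that is not horizontal is thus p_e for
this edge e. -/
theorem IsCompat.exists_isCut {lam : Finset Vertex} {X : Set (List Vertex)} {p : List Vertex}
    (hX : IsBiclosed lam X) (hp : IsTrack lam p) (h : IsCompat X p)
    (hv : ∃ i, (1 ≤ i ∧ i < p.length) ∧ dir p i = true) :
    ∃ i, (1 ≤ i ∧ i < p.length) ∧ dir p i = true ∧ IsCut X p i := by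
  obtain ⟨i, hi, hmin⟩ := exists_edge_min hX hp
    ((Finset.range p.length).filter fun i => 1 ≤ i ∧ dir p i = true)
    (by obtain ⟨i, hi, hd⟩ := hv; exact ⟨i, by simp [hi, hd]⟩) (by simp; tauto)
  simp only [Finset.mem_filter, Finset.mem_range] at hi hmin
  refine ⟨i, ⟨hi.2.1, hi.1⟩, hi.2.2, fun k hk hki => ?_⟩
  constructor
  · intro hd
    exact h k i hk ⟨hi.2.1, hi.1⟩ hd hi.2.2
  · intro hlt
    by_contra hd
    exact hlt.asymm (hmin k ⟨hk.2, hk.1, by simpa using hd⟩ hki)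

/-! ### Extending tracks -/

theorem IsTrack.snoc {lam : Finset Vertex} {q : List Vertex} (hq : IsTrack lam q)
    (hi : IsInterior lam (vx q (q.length - 1))) (d : Bool) :
    IsTrack lam (q ++ [stp d (vx q (q.length - 1))]) ∧
      dir (q ++ [stp d (vx q (q.length - 1))]) q.length = d := by
  have hpos := List.length_pos_iff.mpr hq.1.1
  have hv : vx (q ++ [stp d (vx q (q.length - 1))]) q.length = stp d (vx q (q.length - 1)) := by
    simp [vx]
  have hd : dir (q ++ [stp d (vx q (q.length - 1))]) q.length = d := by
    rw [dir, hv, vx_append_left (by omega)]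
    cases d <;> simp [stp_eq_south]
  refine ⟨⟨isWalk_iff.mpr ⟨by simp, fun k h1 h2 => ?_⟩, ?_, fun k h1 h2 => ?_⟩, hd⟩
  · rcases (show k < q.length ∨ k = q.length by simp at h2; omega) with h | rfl
    · rw [dir_append_left h, vx_append_left h, vx_append_left (by omega)]
      exact hq.1.vx_succ h1 h
    · rw [hd, hv, vx_append_left (by omega)]
  · intro v hv
    rcases List.mem_append.mp hv with h | h
    · exact hq.2.1 v h
    · simp only [List.mem_singleton] at h
      rw [h]; exact hi.stp_mem d
  · simp at h2
    rw [vx_append_left (by omega)]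
    rcases (show k + 1 < q.length ∨ k = q.length - 1 by omega) with h | rfl
    · exact hq.2.2 k h1 h
    · exact hi

theorem vx_cons_succ {v : Vertex} {q : List Vertex} {i : ℕ} : vx (v :: q) (i + 1) = vx q i := by
  simp [vx]

theorem dir_cons_succ {v : Vertex} {q : List Vertex} {i : ℕ} (h : 1 ≤ i) :
    dir (v :: q) (i + 1) = dir q i := by
  obtain ⟨j, rfl⟩ := Nat.exists_eq_add_of_le' h
  simp [dir, vx]

theorem sl_cons_succ {v : Vertex} {q : List Vertex} {i j : ℕ} :
    sl (v :: q) (i + 1) (j + 1) = sl q i j := by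
  simp [sl]

theorem IsTrack.cons {lam : Finset Vertex} {q : List Vertex} (hq : IsTrack lam q)
    (hi : IsInterior lam (vx q 0)) (d : Bool) :
    IsTrack lam (prv d (vx q 0) :: q) ∧ dir (prv d (vx q 0) :: q) 1 = d := by
  have hpos := List.length_pos_iff.mpr hq.1.1
  have hd : dir (prv d (vx q 0) :: q) 1 = d := by
    rw [dir, show 1 = 0 + 1 from rfl, vx_cons_succ]
    conv_lhs => rw [← stp_prv d (vx q 0)]
    simp only [vx, List.getD_cons_zero, Nat.zero_add, Nat.sub_self, prv_stp]
    cases d <;> simp [stp_eq_south]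
  refine ⟨⟨isWalk_iff.mpr ⟨by simp, fun k h1 h2 => ?_⟩, ?_, fun k h1 h2 => ?_⟩, hd⟩
  · simp at h2
    rcases (show k = 1 ∨ ∃ m, k = m + 2 by
      rcases Nat.lt_or_ge k 2 with h | h
      · left; omega
      · right; exact ⟨k - 2, by omega⟩) with rfl | ⟨m, rfl⟩
    · rw [hd, show 1 = 0 + 1 from rfl, vx_cons_succ]
      simp [vx, stp_prv]
    · rw [dir_cons_succ (by omega), show m + 1 + 1 - 1 = m + 1 from rfl, vx_cons_succ, vx_cons_succ]
      exact hq.1.vx_succ (by omega) (by omega)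
  · intro v hv
    rcases List.mem_cons.mp hv with h | h
    · rw [h]; exact hi.prv_mem d
    · exact hq.2.1 v h
  · obtain ⟨m, rfl⟩ := Nat.exists_eq_add_of_le' h1
    rw [vx_cons_succ]
    simp at h2
    rcases Nat.eq_zero_or_pos m with rfl | hm
    · exact hi
    · exact hq.2.2 m hm (by omega)

theorem IsCut.snoc {X : Set (List Vertex)} {q : List Vertex} {i : ℕ} (h : IsCut X q i)
    (hi : i < q.length) {w : Vertex}
    (hw : dir (q ++ [w]) q.length = false ↔ sl q i q.length ∈ X) : IsCut X (q ++ [w]) i := by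
  intro k hk hki
  simp at hk
  rcases (show k < q.length ∨ k = q.length by omega) with hlt | rfl
  · rw [dir_append_left hlt, h k ⟨hk.1, hlt⟩ hki, EdgeLt, EdgeLt, sl_append_left (by omega),
      sl_append_left (by omega)]
  · rw [hw, EdgeLt.of_gt hi, sl_append_left (by omega)]

theorem IsCut.cons {X : Set (List Vertex)} {q : List Vertex} {i : ℕ} (h : IsCut X q i)
    (hi : 1 ≤ i) {w : Vertex} (hw : dir (w :: q) 1 = false ↔ sl q 0 i ∉ X) :
    IsCut X (w :: q) (i + 1) := by
  intro k hk hki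
  simp at hk
  obtain ⟨m, rfl⟩ := Nat.exists_eq_add_of_le' hk.1
  rcases Nat.eq_zero_or_pos m with rfl | hm
  · rw [hw, EdgeLt.of_lt (by omega), sl_cons_succ]
  · rw [dir_cons_succ hm, h m ⟨hm, by omega⟩ (by omega), EdgeLt, EdgeLt, sl_cons_succ, sl_cons_succ]
    simp

/-- While an end of the track is interior, there is exactly one direction in which to prolong it
there that keeps edge `i` a cut. The process stops because a track has at most as many vertices as
the shape. -/
theorem IsCut.exists_isPath {lam : Finset Vertex} {X : Set (List Vertex)} {q : List Vertex} {i : ℕ}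
    (hq : IsTrack lam q) (hi : 1 ≤ i ∧ i < q.length) (h : IsCut X q i) :
    ∃ l r, IsPath lam (l ++ q ++ r) ∧ IsCut X (l ++ q ++ r) (l.length + i) := by
  classical
  induction hn : lam.card - q.length using Nat.strong_induction_on generalizing q i with
  | _ n ih =>
    by_cases h1 : IsInterior lam (vx q (q.length - 1))
    · obtain ⟨ht, hd⟩ := hq.snoc h1 (decide (sl q i q.length ∉ X))
      have hc := h.snoc hi.2 (w := stp (decide (sl q i q.length ∉ X)) (vx q (q.length - 1)))
        (by rw [hd]; simp)
      have := ht.length_le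
      simp at this
      obtain ⟨l, r, hp, hcut⟩ := ih _ (by simp; omega) ht (by simp; omega) hc rfl
      exact ⟨l, _ :: r, by simpa using hp, by simpa using hcut⟩
    · by_cases h0 : IsInterior lam (vx q 0)
      · obtain ⟨ht, hd⟩ := hq.cons h0 (decide (sl q 0 i ∈ X))
        have hc := h.cons hi.1 (w := prv (decide (sl q 0 i ∈ X)) (vx q 0)) (by rw [hd]; simp)
        have := ht.length_le
        simp at this
        obtain ⟨l, r, hp, hcut⟩ := ih _ (by simp; omega) ht (by simp; omega) hc rfl
        refine ⟨l ++ [_], r, by simpa using hp, ?_⟩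
        simpa [Nat.add_comm, Nat.add_left_comm] using hcut
      · exact ⟨[], [], by simpa using isPath_iff.mpr ⟨hq, h0, h1⟩, by simpa using h⟩

theorem IsCut.dir_eq {X : Set (List Vertex)} {p q : List Vertex} {i j a b : ℕ} (hp : IsCut X p i)
    (hq : IsCut X q j) (ha : 1 ≤ a ∧ a < p.length) (hb : 1 ≤ b ∧ b < q.length) (hai : a ≠ i)
    (hbj : b ≠ j) (h : EdgeLt X p a i ↔ EdgeLt X q b j) : dir p a = dir q b := by
  have := (hp a ha hai).trans (h.trans (hq b hb hbj).symm)
  cases h1 : dir p a <;> cases h2 : dir q b <;> simp_all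

/-- By induction the two slices starting at the cut are equal, and their membership in X dictates
the next step of both paths. Neither can stop before the other, since a path ends only at a boundary
vertex. -/
theorem IsCut.agree_right {lam : Finset Vertex} {X : Set (List Vertex)} {p q : List Vertex}
    {i j : ℕ} (hp : IsPath lam p) (hq : IsPath lam q) (hi : 1 ≤ i ∧ i < p.length)
    (hj : 1 ≤ j ∧ j < q.length) (h : vx p i = vx q j) (hpc : IsCut X p i) (hqc : IsCut X q j)
    (k : ℕ) (hk : i + k < p.length) : j + k < q.length ∧ vx p (i + k) = vx q (j + k) := by
  rw [isPath_iff] at hp hq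
  induction k using Nat.strong_induction_on with
  | _ k ih =>
    rcases Nat.eq_zero_or_pos k with rfl | hpos
    · exact ⟨hj.2, h⟩
    · have ⟨h1, h2⟩ := ih (k - 1) (by omega) (by omega)
      have hint := hp.1.2.2 (i + (k - 1)) (by omega) (by omega)
      have h3 : j + k < q.length := by
        by_contra hlt
        rw [h2, show j + (k - 1) = q.length - 1 by omega] at hint
        exact hq.2.2 hint
      have hsl : sl p i (i + k) = sl q j (j + k) := by
        apply ext_vx
        · rw [length_sl (by omega), length_sl (by omega)]; omega
        · intro m hm
          rw [length_sl (by omega)] at hm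
          rw [vx_sl (by omega), vx_sl (by omega)]
          exact (ih m (by omega) (by omega)).2
      refine ⟨h3, ?_⟩
      rw [hp.1.1.vx_succ (by omega) hk, hq.1.1.vx_succ (by omega) h3,
        hpc.dir_eq hqc (a := i + k) (b := j + k) (by omega) (by omega) (by omega) (by omega),
        show i + k - 1 = i + (k - 1) by omega, h2, show j + k - 1 = j + (k - 1) by omega]
      rw [EdgeLt.of_gt (by omega), EdgeLt.of_gt (by omega), hsl]

theorem IsCut.agree_left {lam : Finset Vertex} {X : Set (List Vertex)} {p q : List Vertex}
    {i j : ℕ} (hp : IsPath lam p) (hq : IsPath lam q) (hi : 1 ≤ i ∧ i < p.length)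
    (hj : 1 ≤ j ∧ j < q.length) (h : vx p (i - 1) = vx q (j - 1)) (hpc : IsCut X p i)
    (hqc : IsCut X q j) (k : ℕ) (hk : k + 1 ≤ i) :
    k + 1 ≤ j ∧ vx p (i - (k + 1)) = vx q (j - (k + 1)) := by
  rw [isPath_iff] at hp hq
  induction k using Nat.strong_induction_on with
  | _ k ih =>
    rcases Nat.eq_zero_or_pos k with rfl | hpos
    · exact ⟨hj.1, h⟩
    · have ⟨h1, h2⟩ := ih (k - 1) (by omega) (by omega)
      rw [show k - 1 + 1 = k by omega] at h1 h2
      have hint := hp.1.2.2 (i - k) (by omega) (by omega)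
      have h3 : k + 1 ≤ j := by
        by_contra hlt
        rw [h2, show j - k = 0 by omega] at hint
        exact hq.2.1 hint
      have hsl : sl p (i - k) i = sl q (j - k) j := by
        apply ext_vx
        · rw [length_sl (by omega), length_sl (by omega)]; omega
        · intro m hm
          rw [length_sl (by omega)] at hm
          rw [vx_sl (by omega), vx_sl (by omega)]
          have := (ih (k - m - 1) (by omega) (by omega)).2
          rwa [show i - (k - m - 1 + 1) = i - k + m by omega,
            show j - (k - m - 1 + 1) = j - k + m by omega] at this
      refine ⟨h3, ?_⟩
      have e1 := hp.1.1.vx_succ (i := i - k) (by omega) (by omega)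
      have e2 := hq.1.1.vx_succ (i := j - k) (by omega) (by omega)
      rw [h2, e2, hpc.dir_eq hqc (a := i - k) (b := j - k) (by omega) (by omega) (by omega)
        (by omega)] at e1
      · have := stp_injective _ e1
        rw [Nat.sub_sub, Nat.sub_sub] at this
        exact this.symm
      · rw [EdgeLt.of_lt (by omega), EdgeLt.of_lt (by omega), hsl]

theorem IsCut.unique {lam : Finset Vertex} {X : Set (List Vertex)} {p q : List Vertex}
    {i j : ℕ} (hp : IsPath lam p) (hq : IsPath lam q) (hi : 1 ≤ i ∧ i < p.length)
    (hj : 1 ≤ j ∧ j < q.length) (h : vx p (i - 1) = vx q (j - 1)) (h' : vx p i = vx q j)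
    (hpc : IsCut X p i) (hqc : IsCut X q j) : p = q := by
  have hij : i = j := by
    have h1 := (IsCut.agree_left hp hq hi hj h hpc hqc (i - 1) (by omega)).1
    have h2 := (IsCut.agree_left hq hp hj hi h.symm hqc hpc (j - 1) (by omega)).1
    omega
  subst hij
  have hr := IsCut.agree_right hp hq hi hj h' hpc hqc
  apply ext_vx
  · have h1 := (hr (p.length - 1 - i) (by omega)).1
    have h2 := (IsCut.agree_right hq hp hj hi h'.symm hqc hpc (q.length - 1 - i) (by omega)).1
    omega
  · intro k hk
    rcases Nat.lt_or_ge k i with hlt | hge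
    · have := (IsCut.agree_left hp hq hi hj h hpc hqc (i - 1 - k) (by omega)).2
      rwa [show i - (i - 1 - k + 1) = k by omega] at this
    · have := (hr (k - i) (by omega)).2
      rwa [show i + (k - i) = k by omega] at this

/-! ### Entering and leaving a slice, in terms of directions of edges -/

theorem sl_eq_cons {p : List Vertex} {a b : ℕ} (hab : a < b) (hb : b ≤ p.length) :
    sl p a b = vx p a :: sl p (a + 1) b := by
  apply ext_vx
  · rw [List.length_cons, length_sl hb, length_sl hb]; omega
  · intro i hi
    rw [length_sl hb] at hi
    rw [vx_sl (by omega)]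
    cases i with
    | zero => simp [vx]
    | succ n => rw [vx_cons_succ, vx_sl (by omega)]; congr 1; omega

theorem sl_succ {p : List Vertex} {a b : ℕ} (hab : a ≤ b) (hb : b < p.length) :
    sl p a (b + 1) = sl p a b ++ [vx p b] := by
  rw [← sl_append hab (Nat.le_succ b), sl_eq_cons (Nat.lt_succ_self b) hb]
  congr 2
  simp [sl]

theorem IsWalk.enters_iff {p : List Vertex} (hp : IsWalk p) {a b : ℕ} (hab : a < b)
    (hb : b ≤ p.length) (d : Bool) :
    (∃ w, (sl p a b).head? = some (stp d w) ∧ (w :: sl p a b) <:+: p) ↔ 1 ≤ a ∧ dir p a = d := by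
  have hne := sl_ne_nil hab hb
  rw [head?_eq_vx hne, vx_sl (by omega), Nat.add_zero]
  constructor
  · rintro ⟨w, h1, h2⟩
    obtain ⟨i, j, hij, hj, h⟩ := infix_iff_sl.mp h2
    have hl := congrArg List.length h
    rw [List.length_cons, length_sl hb, length_sl hj] at hl
    have e0 := congrArg (fun l => vx l 0) h
    have e1 := congrArg (fun l => vx l 1) h
    rw [vx_sl (by omega)] at e0
    rw [vx_sl (by omega), show 1 = 0 + 1 from rfl, vx_cons_succ, vx_sl (by omega)] at e1
    have := hp.vx_injective (by omega) (by omega) e1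
    have ha : 1 ≤ a := by omega
    refine ⟨ha, (hp.dir_eq ha (by omega)).mpr ?_⟩
    rw [Option.some.inj h1, show a - 1 = i + 0 by omega, ← e0]
    simp [vx]
  · rintro ⟨ha, hd⟩
    refine ⟨vx p (a - 1), ?_, infix_iff_sl.mpr ⟨a - 1, b, by omega, hb, ?_⟩⟩
    · rw [(hp.dir_eq ha (by omega)).mp hd]
    · rw [sl_eq_cons (a := a - 1) (by omega) hb, Nat.sub_add_cancel ha]

theorem IsWalk.leaves_iff {p : List Vertex} (hp : IsWalk p) {a b : ℕ} (hab : a < b)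
    (hb : b ≤ p.length) (d : Bool) :
    (∃ w, (sl p a b).getLast? = some w ∧ (sl p a b ++ [stp d w]) <:+: p) ↔
      b < p.length ∧ dir p b = d := by
  have hne := sl_ne_nil hab hb
  rw [getLast?_eq_vx hne, length_sl hb, vx_sl (by omega)]
  constructor
  · rintro ⟨w, h1, h2⟩
    obtain ⟨i, j, hij, hj, h⟩ := infix_iff_sl.mp h2
    have hl := congrArg List.length h
    rw [List.length_append, length_sl hb, length_sl hj, List.length_singleton] at hl
    have e0 := congrArg (fun l => vx l 0) h
    have e1 := congrArg (fun l => vx l (b - a)) h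
    rw [vx_append_left (by rw [length_sl hb]; omega), vx_sl (by omega), vx_sl (by omega)] at e0
    have := hp.vx_injective (by omega) (by omega) e0
    have e2 := vx_append_right (x := sl p a b) (y := [stp d w]) (i := 0)
    rw [Nat.add_zero, length_sl hb, e1, vx_sl (by omega)] at e2
    have hb' : b < p.length := by omega
    refine ⟨hb', (hp.dir_eq (by omega) hb').mpr ?_⟩
    rw [show i + (b - a) = b by omega] at e2
    rw [e2, ← Option.some.inj h1, show a + (b - a - 1) = b - 1 by omega]
    simp [vx]
  · rintro ⟨hb', hd⟩
    refine ⟨_, rfl, infix_iff_sl.mpr ⟨a, b + 1, by omega, hb', ?_⟩⟩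
    rw [sl_succ hab.le hb', (hp.dir_eq (by omega) hb').mp hd,
      show a + (b - a - 1) = b - 1 by omega]

theorem isPart_iff {p : List Vertex} {v v' : Vertex} {s : List Vertex} :
    IsPart p v v' s ↔ ∃ a b, a < b ∧ b ≤ p.length ∧ s = sl p a b ∧ vx p a = v ∧
      vx p (b - 1) = v' := by
  constructor
  · rintro ⟨h, h1, h2⟩
    have hne : s ≠ [] := by rintro rfl; simp at h1
    rw [head?_eq_vx hne] at h1
    rw [getLast?_eq_vx hne] at h2
    obtain ⟨a, b, hab, hb, rfl⟩ := infix_iff_sl.mp h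
    have hpos := List.length_pos_iff.mpr hne
    rw [length_sl hb] at hpos h2
    rw [vx_sl (by omega)] at h1 h2
    refine ⟨a, b, by omega, hb, rfl, Option.some.inj h1, ?_⟩
    rw [← Option.some.inj h2]; congr 1; omega
  · rintro ⟨a, b, hab, hb, rfl, rfl, rfl⟩
    have hne := sl_ne_nil hab hb
    refine ⟨infix_iff_sl.mpr ⟨a, b, hab.le, hb, rfl⟩, ?_, ?_⟩
    · rw [head?_eq_vx hne, vx_sl (by omega)]; rfl
    · rw [getLast?_eq_vx hne, length_sl hb, vx_sl (by omega)]; congr 2; omega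

/-! ### The paths `p_e` -/

/-- If e is edge `i`, then p[u', u] is `sl p k i` for the edge `k` entering u', and p[v, v'] is `sl
p i k` for the edge `k` leaving v'. Both rules therefore compare `k` with `i` in the order given by
X. -/
theorem isEtaPath_iff {lam : Finset Vertex} {X : Set (List Vertex)} {u : Vertex}
    {p : List Vertex} : IsEtaPath lam X u p ↔ IsPath lam p ∧ ∃ i, (1 ≤ i ∧ i < p.length) ∧
      vx p (i - 1) = u ∧ vx p i = south u ∧ IsCut X p i := by
  constructor
  · rintro ⟨hp, he, hent, hlv⟩
    refine ⟨hp, ?_⟩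
    obtain ⟨hw, hm, hint⟩ := hp.track
    obtain ⟨a, b, hab, hb, he⟩ := infix_iff_sl.mp he
    have hl := congrArg List.length he
    rw [length_sl hb] at hl
    simp at hl
    have e0 := congrArg (fun l => vx l 0) he
    have e1 := congrArg (fun l => vx l 1) he
    rw [vx_sl (by omega)] at e0 e1
    change u = vx p a at e0
    change south u = vx p (a + 1) at e1
    refine ⟨a + 1, by omega, by simp [e0], e1.symm, fun k hk hka => ?_⟩
    rcases hka.lt_or_gt with hlt | hgt
    · have := hent (vx p k) (sl p k (a + 1)) (hint k hk.1 (by omega))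
        (isPart_iff.mpr ⟨k, a + 1, hlt, by omega, rfl, rfl, by simp [e0]⟩)
      rw [EdgeLt.of_lt hlt]
      constructor
      · intro hd hmem
        have := ((hw.enters_iff hlt (by omega) true).mp (this.1 hmem)).2
        simp [hd] at this
      · intro hmem
        exact ((hw.enters_iff hlt (by omega) false).mp (this.2 hmem)).2
    · have := hlv (vx p (k - 1)) (sl p (a + 1) k) (hint (k - 1) (by omega) (by omega))
        (isPart_iff.mpr ⟨a + 1, k, hgt, by omega, rfl, e1.symm, rfl⟩)
      rw [EdgeLt.of_gt hgt]
      constructor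
      · intro hd
        by_contra hmem
        have := ((hw.leaves_iff hgt (by omega) true).mp (this.2 hmem)).2
        simp [hd] at this
      · intro hmem
        exact ((hw.leaves_iff hgt (by omega) false).mp (this.1 hmem)).2
  · rintro ⟨hp, i, hi, h1, h2, hc⟩
    obtain ⟨⟨hw, hm, hint⟩, hn0, hn1⟩ := isPath_iff.mp hp
    refine ⟨hp, ?_, ?_, ?_⟩
    · refine infix_iff_sl.mpr ⟨i - 1, i + 1, by omega, by omega, ?_⟩
      rw [sl_eq_cons (by omega) (by omega), Nat.sub_add_cancel hi.1, sl_succ le_rfl hi.2, h1, h2]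
      simp [sl]
    · intro u' s hu' hs
      obtain ⟨a, b, hab, hb, rfl, rfl, hlast⟩ := isPart_iff.mp hs
      have : b = i := by
        have := hw.vx_injective (by omega) (by omega) (hlast.trans h1.symm)
        omega
      subst this
      have ha : 1 ≤ a := by
        by_contra h
        exact hn0 (by rwa [show a = 0 by omega] at hu')
      have := hc a ⟨ha, by omega⟩ hab.ne
      rw [EdgeLt.of_lt hab] at this
      exact ⟨fun h => (hw.enters_iff hab hb true).mpr ⟨ha, by simpa [h] using this⟩,
        fun h => (hw.enters_iff hab hb false).mpr ⟨ha, this.mpr h⟩⟩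
    · intro v' s hv' hs
      obtain ⟨a, b, hab, hb, rfl, hfirst, rfl⟩ := isPart_iff.mp hs
      have : a = i := hw.vx_injective (by omega) (by omega) (hfirst.trans h2.symm)
      subst this
      have hb' : b < p.length := by
        by_contra h
        exact hn1 (by rwa [show b = p.length by omega] at hv')
      have := hc b ⟨by omega, hb'⟩ hab.ne'
      rw [EdgeLt.of_gt hab] at this
      exact ⟨fun h => (hw.leaves_iff hab hb false).mpr ⟨hb', this.mpr h⟩,
        fun h => (hw.leaves_iff hab hb true).mpr ⟨hb', by simpa [h] using this⟩⟩

theorem existsUnique_isEtaPath {lam : Finset Vertex} (X : Set (List Vertex)) {u : Vertex}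
    (hu : IsVerticalEdge lam u) : ∃! p, IsEtaPath lam X u p := by
  have hv0 : vx [u, south u] 0 = u := rfl
  have hv1 : vx [u, south u] 1 = south u := rfl
  have ht : IsTrack lam [u, south u] := by
    refine ⟨⟨by simp, by simp⟩, by simpa [IsVerticalEdge] using hu, fun i h1 h2 => ?_⟩
    simp at h2; omega
  -- The track consisting of e alone has no other edge, so it is the seed to be extended.
  have hc : IsCut X [u, south u] 1 := fun k hk hk1 => by simp at hk; omega
  obtain ⟨l, r, hp, hcut⟩ := hc.exists_isPath ht (by simp)
  refine ⟨_, isEtaPath_iff.mpr ⟨hp, l.length + 1, by simp, ?_, ?_, hcut⟩, fun q hq => ?_⟩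
  · rw [List.append_assoc, Nat.add_sub_cancel, ← Nat.add_zero l.length, vx_append_right]; rfl
  · rw [List.append_assoc, vx_append_right]; rfl
  · obtain ⟨hq, j, hj, e0, e1, hqc⟩ := isEtaPath_iff.mp hq
    refine IsCut.unique hq hp hj (j := l.length + 1) (by simp) ?_ ?_ hqc hcut
    · rw [e0, List.append_assoc, Nat.add_sub_cancel, ← Nat.add_zero l.length, vx_append_right]; rfl
    · rw [e1, List.append_assoc, vx_append_right]; rfl

theorem IsTrack.isHorizontal_iff {lam : Finset Vertex} {p : List Vertex} (hp : IsTrack lam p) :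
    IsHorizontal p ↔ ∀ i, 1 ≤ i ∧ i < p.length → dir p i = false := by
  unfold IsHorizontal
  rw [List.isChain_iff_getElem]
  constructor
  · intro h i hi
    have := h (i - 1) (by omega)
    rw [← vx_eq_getElem, ← vx_eq_getElem, Nat.sub_add_cancel hi.1] at this
    exact (hp.1.dir_eq hi.1 hi.2).mpr this
  · intro h i hi
    rw [← vx_eq_getElem hi, ← vx_eq_getElem]
    exact (hp.1.dir_eq (by omega) hi).mp (h (i + 1) ⟨by omega, hi⟩)

theorem IsTrack.isVertical_iff {lam : Finset Vertex} {p : List Vertex} (hp : IsTrack lam p) :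
    IsVertical p ↔ ∀ i, 1 ≤ i ∧ i < p.length → dir p i = true := by
  unfold IsVertical
  rw [List.isChain_iff_getElem]
  constructor
  · intro h i hi
    have := h (i - 1) (by omega)
    rw [← vx_eq_getElem, ← vx_eq_getElem, Nat.sub_add_cancel hi.1] at this
    exact (hp.1.dir_eq hi.1 hi.2).mpr this
  · intro h i hi
    rw [← vx_eq_getElem hi, ← vx_eq_getElem]
    exact (hp.1.dir_eq (by omega) hi).mp (h (i + 1) ⟨by omega, hi⟩)

theorem mem_eta_iff {lam : Finset Vertex} {X : Set (List Vertex)} (hX : IsBiclosed lam X)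
    {p : List Vertex} : p ∈ eta lam X ↔ IsPath lam p ∧ IsCompat X p := by
  constructor
  · rintro (⟨u, -, h⟩ | ⟨hp, hh⟩)
    · obtain ⟨hp, i, hi, -, -, hc⟩ := isEtaPath_iff.mp h
      exact ⟨hp, hc.isCompat hX hp.track hi⟩
    · refine ⟨hp, fun i j hi hj h1 h2 => ?_⟩
      rw [hp.track.isHorizontal_iff.mp hh j hj] at h2
      exact absurd h2 (by simp)
  · rintro ⟨hp, hc⟩
    by_cases hv : ∃ i, (1 ≤ i ∧ i < p.length) ∧ dir p i = true
    · obtain ⟨i, hi, hd, hcut⟩ := hc.exists_isCut hX hp.track hv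
      have hs : vx p i = south (vx p (i - 1)) := (hp.track.1.dir_eq hi.1 hi.2).mp hd
      refine Or.inl ⟨vx p (i - 1), ⟨?_, ?_⟩, isEtaPath_iff.mpr ⟨hp, i, hi, rfl, hs, hcut⟩⟩
      · exact hp.track.2.1 _ (mem_iff_vx.mpr ⟨_, by omega, rfl⟩)
      · rw [← hs]; exact hp.track.2.1 _ (mem_iff_vx.mpr ⟨_, hi.2, rfl⟩)
    · push Not at hv
      exact Or.inr ⟨hp, hp.track.isHorizontal_iff.mpr fun i hi => by simpa using hv i hi⟩

/-! ### Kissing -/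

/-- The segments that `p` enters in direction `d` and leaves in the other direction. -/
def bends (d : Bool) (p : List Vertex) : Set (List Vertex) :=
  {s | ∃ i j, 1 ≤ i ∧ i < j ∧ j < p.length ∧ s = sl p i j ∧ dir p i = d ∧ dir p j = !d}

theorem kissAlong_iff {s p q : List Vertex} (hp : IsWalk p) (hq : IsWalk q) :
    KissAlong s p q ↔ s ∈ bends false p ∧ s ∈ bends true q := by
  have key : ∀ (d : Bool) {p : List Vertex}, IsWalk p →
      ((∃ w, s.head? = some (stp d w) ∧ (w :: s) <:+: p) ∧
        (∃ w, s.getLast? = some w ∧ (s ++ [stp (!d) w]) <:+: p) ↔ s ∈ bends d p) := by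
    intro d p hp
    constructor
    · rintro ⟨⟨w, hw, hin⟩, h2⟩
      obtain ⟨a, b, hab, hb, rfl⟩ := infix_iff_sl.mp ((List.suffix_cons w s).isInfix.trans hin)
      have hpos : (sl p a b).length ≠ 0 := by
        intro h0; rw [List.length_eq_zero_iff.mp h0] at hw; simp at hw
      rw [length_sl hb] at hpos
      have e1 := (hp.enters_iff (by omega) hb d).mp ⟨w, hw, hin⟩
      have e2 := (hp.leaves_iff (by omega) hb (!d)).mp h2
      exact ⟨a, b, e1.1, by omega, e2.1, rfl, e1.2, e2.2⟩
    · rintro ⟨i, j, hi, hij, hj, rfl, h1, h2⟩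
      exact ⟨(hp.enters_iff hij hj.le d).mpr ⟨hi, h1⟩,
        (hp.leaves_iff hij hj.le (!d)).mpr ⟨hj, h2⟩⟩
  rw [← key false hp, ← key true hq]
  unfold KissAlong
  exact (and_assoc (a := EntersWest p s) (b := LeavesSouth p s)).symm

theorem kissing_iff {p q : List Vertex} (hp : IsWalk p) (hq : IsWalk q) :
    Kissing p q ↔ ∃ d s, s ∈ bends (!d) p ∧ s ∈ bends d q := by
  unfold Kissing
  constructor
  · rintro ⟨s, h | h⟩
    · exact ⟨true, s, (kissAlong_iff hp hq).mp h⟩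
    · exact ⟨false, s, ((kissAlong_iff hq hp).mp h).symm⟩
  · rintro ⟨d, s, h⟩
    cases d
    · exact ⟨s, Or.inr ((kissAlong_iff hq hp).mpr h.symm)⟩
    · exact ⟨s, Or.inl ((kissAlong_iff hp hq).mpr h)⟩

theorem IsTrack.isSegment_of_mem_bends {lam : Finset Vertex} {p s : List Vertex} {d : Bool}
    (hp : IsTrack lam p) (h : s ∈ bends d p) : IsSegment lam s := by
  obtain ⟨i, j, hi, hij, hj, rfl, -, -⟩ := h
  exact hp.isSegment hi hij hj

/-- A horizontal and a vertical edge bound a bend whose kind says which comes first along `p`; the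
required order of the two is the required membership of that bend. -/
theorem isCompat_iff {lam : Finset Vertex} {X : Set (List Vertex)} {p : List Vertex}
    (hp : IsTrack lam p) : IsCompat X p ↔ ∀ d, bends d p ⊆ sgn lam d X := by
  constructor
  · rintro h d s ⟨i, j, hi, hij, hj, rfl, h1, h2⟩
    rw [mem_sgn (hp.isSegment hi hij hj)]
    cases d
    · have := h i j ⟨hi, by omega⟩ ⟨by omega, hj⟩ h1 h2
      rw [EdgeLt.of_lt hij] at this
      simpa using this
    · have := h j i ⟨by omega, hj⟩ ⟨hi, by omega⟩ h2 h1
      rw [EdgeLt.of_gt hij] at this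
      simpa using this
  · intro h i j hi hj h1 h2
    have hne : i ≠ j := by rintro rfl; simp [h1] at h2
    rcases hne.lt_or_gt with hlt | hgt
    · have := h false ⟨i, j, hi.1, hlt, hj.2, rfl, h1, h2⟩
      rw [mem_sgn (hp.isSegment hi.1 hlt hj.2)] at this
      rw [EdgeLt.of_lt hlt]; simpa using this
    · have := h true ⟨j, i, hj.1, hgt, hi.2, rfl, h2, h1⟩
      rw [mem_sgn (hp.isSegment hj.1 hgt hi.2)] at this
      rw [EdgeLt.of_gt hgt]; simpa using this

theorem mem_eta_iff_bends {lam : Finset Vertex} {X : Set (List Vertex)} (hX : IsBiclosed lam X)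
    {p : List Vertex} : p ∈ eta lam X ↔ IsPath lam p ∧ ∀ d, bends d p ⊆ sgn lam d X := by
  rw [mem_eta_iff hX]
  exact and_congr_right fun hp => isCompat_iff hp.track

/-! ### Closures -/

/-- The closure of a set of segments under composition. -/
inductive Cl (lam : Finset Vertex) (T : Set (List Vertex)) : List Vertex → Prop
  | base {s} : s ∈ T → Cl lam T s
  | comp {s t} : Cl lam T s → Cl lam T t → IsSegment lam (s ++ t) → Cl lam T (s ++ t)

/-- The closure of a set of segments, as a set. -/
def cl (lam : Finset Vertex) (T : Set (List Vertex)) : Set (List Vertex) := {s | Cl lam T s}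

theorem subset_cl {lam : Finset Vertex} {T : Set (List Vertex)} : T ⊆ cl lam T :=
  fun _ h => Cl.base h

theorem cl_subset {lam : Finset Vertex} {T X : Set (List Vertex)} (hX : IsClosedSet lam X)
    (h : T ⊆ X) : cl lam T ⊆ X := by
  intro s hs
  induction hs with
  | base hs => exact h hs
  | comp h1 h2 hst ih1 ih2 => exact hX _ ih1 _ ih2 hst

theorem cl_mono {lam : Finset Vertex} {T U : Set (List Vertex)} (h : T ⊆ U) :
    cl lam T ⊆ cl lam U :=
  cl_subset (fun _ hs _ ht hst => Cl.comp hs ht hst) (h.trans subset_cl)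

/-- Coclosedness need only be tested on the generators: a cut of a composite falls inside one of its
two factors, or between them. -/
theorem isBiclosed_cl {lam : Finset Vertex} {T : Set (List Vertex)}
    (hT : ∀ s ∈ T, IsSegment lam s)
    (hsplit : ∀ a b, a ≠ [] → b ≠ [] → a ++ b ∈ T → a ∈ cl lam T ∨ b ∈ cl lam T) :
    IsBiclosed lam (cl lam T) := by
  have hseg : ∀ s ∈ cl lam T, IsSegment lam s := by
    intro s hs
    induction hs with
    | base hs => exact hT _ hs
    | comp _ _ hst _ _ => exact hst
  refine ⟨hseg, fun s hs t ht hst => Cl.comp hs ht hst, ?_⟩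
  have key : ∀ s ∈ cl lam T, ∀ a b, a ≠ [] → b ≠ [] → s = a ++ b →
      a ∈ cl lam T ∨ b ∈ cl lam T := by
    intro s hs
    induction hs with
    | base hs => rintro a b ha hb rfl; exact hsplit a b ha hb hs
    | @comp x y hx hy hxy ih1 ih2 =>
      intro a b ha hb h
      have hab : IsSegment lam (a ++ b) := h ▸ hxy
      rcases List.append_eq_append_iff.mp h with ⟨z, rfl, rfl⟩ | ⟨z, rfl, rfl⟩
      · by_cases hz : z = []
        · subst hz; left; simpa [cl] using hx
        · rcases ih2 z b hz hb rfl with h | h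
          · exact Or.inl (Cl.comp hx h (hab.append_left ha))
          · exact Or.inr h
      · by_cases hz : z = []
        · subst hz; right; simpa [cl] using hy
        · rcases ih1 a z ha hz rfl with h | h
          · exact Or.inl h
          · exact Or.inr (Cl.comp h hy (hab.append_right hb))
  intro s hs t ht hst
  refine ⟨hst, fun hmem => ?_⟩
  exact (key _ hmem s t hs.1.1.1 ht.1.1.1 rfl).elim hs.2 ht.2

/-- The segments along which some element of `F` bends. -/
def allBends (d : Bool) (F : Set (List Vertex)) : Set (List Vertex) := {s | ∃ p ∈ F, s ∈ bends d p}

theorem isBiclosed_cl_allBends {lam : Finset Vertex} {F : Set (List Vertex)}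
    (hF : ∀ p ∈ F, IsPath lam p) (d : Bool) : IsBiclosed lam (cl lam (allBends d F)) := by
  apply isBiclosed_cl
  · rintro s ⟨p, hp, hs⟩
    exact (hF p hp).track.isSegment_of_mem_bends hs
  · rintro a b ha hb ⟨p, hp, i, j, hi, hij, hj, h, h1, h2⟩
    have hl := congrArg List.length h
    have ha' := List.length_pos_iff.mpr ha
    have hb' := List.length_pos_iff.mpr hb
    rw [List.length_append, length_sl hj.le] at hl
    have ea : a = sl p i (i + a.length) := by
      have := sl_append_left (x := a) (y := b) (i := 0) (j := a.length) le_rfl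
      rw [sl_length, h, sl_sl (by omega)] at this
      exact this.symm
    have eb : b = sl p (i + a.length) j := by
      have := sl_append_right (x := a) (y := b) (i := 0) (j := b.length)
      rw [sl_length, h, sl_sl (by omega)] at this
      rw [← this, Nat.add_zero]
      congr 1; omega
    -- The edge between the two pieces either enters the right piece as a bend of kind `d` must be
    -- entered, or leaves the left piece as such a bend must be left.
    by_cases hd : dir p (i + a.length) = d
    · exact Or.inr (subset_cl ⟨p, hp, i + a.length, j, by omega, by omega, hj, eb, hd, h2⟩)
    · exact Or.inl (subset_cl ⟨p, hp, i, i + a.length, hi, by omega, by omega, ea, h1, by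
        cases d <;> simpa using hd⟩)

/-- Non-kissing passes from the bends to their closure: if a composite is a bend of `q`, the
direction of `q` between the two factors makes one of them a bend of the same kind. -/
theorem not_mem_bends_of_mem_cl {lam : Finset Vertex} {F : Set (List Vertex)} {q : List Vertex}
    (hF : ∀ p ∈ F, IsPath lam p) (hq : IsPath lam q) (hk : ∀ p ∈ F, ¬ Kissing p q) {d : Bool}
    {s : List Vertex} (hs : s ∈ cl lam (allBends d F)) : s ∉ bends (!d) q := by
  induction hs with
  | base hs =>
    obtain ⟨p, hp, hs⟩ := hs
    intro hsq
    exact hk p hp ((kissing_iff (hF p hp).1 hq.1).mpr ⟨!d, _, by rwa [Bool.not_not], hsq⟩)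
  | @comp x y hx hy hxy ih1 ih2 =>
    rintro ⟨i, j, hi, hij, hj, h, h1, h2⟩
    have hB := isBiclosed_cl_allBends hF d
    have hxp := (hB.1 hx).length_pos
    have hyp := (hB.1 hy).length_pos
    have hl := congrArg List.length h
    rw [List.length_append, length_sl hj.le] at hl
    have ex : x = sl q i (i + x.length) := by
      have := sl_append_left (x := x) (y := y) (i := 0) (j := x.length) le_rfl
      rw [sl_length, h, sl_sl (by omega)] at this
      exact this.symm
    have ey : y = sl q (i + x.length) j := by
      have := sl_append_right (x := x) (y := y) (i := 0) (j := y.length)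
      rw [sl_length, h, sl_sl (by omega)] at this
      rw [← this, Nat.add_zero]
      congr 1; omega
    by_cases hd : dir q (i + x.length) = d
    · exact ih1 ⟨i, i + x.length, hi, by omega, by omega, ex, h1, by simpa using hd⟩
    · exact ih2 ⟨i + x.length, j, by omega, by omega, hj, ey, by cases d <;> simpa using hd, h2⟩

/-! ### SW- and NE-subsegments, and the closure of the bends of η(X) -/

/-- The SW-subsegments of `s` for `d = true`, and its NE-subsegments for `d = false`. -/
def subs (d : Bool) (s : List Vertex) : Set (List Vertex) :=
  {t | ∃ i j, i < j ∧ j ≤ s.length ∧ t = sl s i j ∧ (i = 0 ∨ dir s i = d) ∧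
    (j = s.length ∨ dir s j = !d)}

theorem self_mem_subs {d : Bool} {s : List Vertex} (hs : s ≠ []) : s ∈ subs d s :=
  ⟨0, s.length, List.length_pos_iff.mpr hs, le_rfl, (sl_length s).symm, Or.inl rfl, Or.inl rfl⟩

theorem subs_subset_bends {d : Bool} {p s : List Vertex} (h : s ∈ bends d p) :
    subs d s ⊆ bends d p := by
  obtain ⟨i, j, hi, hij, hj, rfl, h1, h2⟩ := h
  rintro t ⟨a, b, hab, hb, rfl, ha, hb'⟩
  rw [length_sl hj.le] at hb hb'
  refine ⟨i + a, i + b, by omega, by omega, by omega, sl_sl (by omega), ?_, ?_⟩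
  · rcases Nat.eq_zero_or_pos a with rfl | hpos
    · exact h1
    · have := ha.resolve_left (by omega)
      rwa [dir_sl (by omega) (by omega)] at this
  · rcases hb.eq_or_lt with rfl | hlt
    · rwa [show i + (j - i) = j by omega]
    · have := hb'.resolve_left (by omega)
      rwa [dir_sl (by omega) (by omega)] at this

theorem subs_append {d : Bool} {x y t : List Vertex} (h : t ∈ subs d (x ++ y)) :
    t ∈ subs d x ∨ t ∈ subs d y ∨ ∃ t₁ ∈ subs d x, ∃ t₂ ∈ subs d y, t = t₁ ++ t₂ := by
  obtain ⟨i, j, hij, hj, rfl, h1, h2⟩ := h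
  rw [List.length_append] at hj h2
  have h1' : i < x.length → i = 0 ∨ dir x i = d := fun hlt => by
    rwa [dir_append_left hlt] at h1
  have h2' : ∀ k, 1 ≤ k → j = x.length + k → k = y.length ∨ dir y k = !d := by
    rintro k hk rfl
    rw [dir_append_right hk] at h2
    exact h2.imp_left fun h => by omega
  have h3 : j < x.length → dir x j = !d := fun hlt => by
    rw [dir_append_left hlt] at h2
    exact h2.resolve_left (by omega)
  have h4 : ∀ k, 1 ≤ k → i = x.length + k → dir y k = d := by
    rintro k hk rfl
    rw [dir_append_right hk] at h1
    exact h1.resolve_left (by omega)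
  rcases Nat.lt_or_ge x.length j with hxj | hxj
  · obtain ⟨k, rfl⟩ := Nat.exists_eq_add_of_lt hxj
    rw [Nat.add_assoc] at h2' ⊢
    rcases Nat.lt_or_ge i x.length with hxi | hxi
    · refine Or.inr (Or.inr ⟨sl x i x.length, ⟨i, x.length, hxi, le_rfl, rfl, h1' hxi, Or.inl rfl⟩,
        sl y 0 (k + 1), ⟨0, k + 1, by omega, by omega, rfl, Or.inl rfl, h2' _ (by omega) rfl⟩, ?_⟩)
      rw [← sl_append hxi.le (Nat.le_add_right x.length (k + 1)), sl_append_left le_rfl]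
      congr 1
      exact sl_append_right (i := 0)
    · obtain ⟨m, rfl⟩ := Nat.exists_eq_add_of_le hxi
      refine Or.inr (Or.inl ⟨m, k + 1, by omega, by omega, sl_append_right, ?_,
        h2' _ (by omega) rfl⟩)
      rcases Nat.eq_zero_or_pos m with rfl | hm
      · exact Or.inl rfl
      · exact Or.inr (h4 m hm rfl)
  · refine Or.inl ⟨i, j, hij, hxj, sl_append_left hxj, h1' (by omega), ?_⟩
    rcases hxj.eq_or_lt with rfl | hlt
    · exact Or.inl rfl
    · exact Or.inr (h3 hlt)

theorem subs_isSegment {lam : Finset Vertex} {d : Bool} {s t : List Vertex} (hs : IsSegment lam s)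
    (ht : t ∈ subs d s) : IsSegment lam t := by
  obtain ⟨i, j, hij, hj, rfl, -, -⟩ := ht
  exact hs.part hij hj

theorem eta_isPath {lam : Finset Vertex} {X : Set (List Vertex)} (hX : IsBiclosed lam X) :
    ∀ p ∈ eta lam X, IsPath lam p := fun _ hp => ((mem_eta_iff hX).mp hp).1

/-- If `s` is composed of bends of `η(X)`, then all its SW-subsegments (respectively
NE-subsegments) are in `X` (respectively in its complement). -/
theorem subs_subset_of_mem_cl {lam : Finset Vertex} {X : Set (List Vertex)} (hX : IsBiclosed lam X)
    {d : Bool} {s : List Vertex} (hs : s ∈ cl lam (allBends d (eta lam X))) :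
    subs d s ⊆ sgn lam d X := by
  induction hs with
  | base hs =>
    obtain ⟨p, hp, hs⟩ := hs
    exact (subs_subset_bends hs).trans (((mem_eta_iff_bends hX).mp hp).2 d)
  | comp _ _ hxy ih1 ih2 =>
    intro t ht
    rcases subs_append ht with h | h | ⟨t₁, h1, t₂, h2, rfl⟩
    · exact ih1 h
    · exact ih2 h
    · exact (hX.signed d).2.1 _ (ih1 h1) _ (ih2 h2) (subs_isSegment hxy ht)

theorem IsSegment.isTrack {lam : Finset Vertex} {s : List Vertex} (hs : IsSegment lam s) :
    IsTrack lam s :=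
  ⟨hs.1, fun v hv => (hs.2 v hv).mem, fun i _ hi => hs.2 _ (mem_iff_vx.mpr ⟨i, by omega, rfl⟩)⟩

/-- Put an edge of direction `d` before `s` and one of the other direction after it. The hypotheses
say that the first edge is a cut of this track, so the track extends to a path of η(X) that bends
along `s`. -/
theorem mem_allBends_eta {lam : Finset Vertex} {X : Set (List Vertex)} (hX : IsBiclosed lam X)
    {d : Bool} {s : List Vertex} (hs : IsSegment lam s)
    (h : ∀ m, 1 ≤ m → m < s.length → (dir s m = d ↔ sl s 0 m ∉ sgn lam d X))
    (hmem : s ∈ sgn lam d X) : s ∈ allBends d (eta lam X) := by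
  have hpos := hs.length_pos
  obtain ⟨ht1, hd1⟩ := hs.isTrack.snoc (hs.2 _ (mem_iff_vx.mpr ⟨_, by omega, rfl⟩)) (!d)
  have hv0 : vx (s ++ [stp (!d) (vx s (s.length - 1))]) 0 = vx s 0 := vx_append_left hpos
  obtain ⟨ht2, hd2⟩ := ht1.cons (hv0 ▸ hs.2 _ (mem_iff_vx.mpr ⟨0, hpos, rfl⟩)) d
  set r := s ++ [stp (!d) (vx s (s.length - 1))] with hr
  set q := prv d (vx r 0) :: r with hq
  have hlr : r.length = s.length + 1 := by simp [hr]
  have hlq : q.length = s.length + 2 := by simp [hq, hlr]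
  have hslq : ∀ m, m ≤ s.length → sl q 1 (m + 1) = sl s 0 m := fun m hm => by
    rw [hq, sl_cons_succ (i := 0), hr, sl_append_left hm]
  have hcut : IsCut X q 1 := by
    intro k hk hk1
    obtain ⟨m, rfl⟩ := Nat.exists_eq_add_of_le' hk.1
    have hm : 1 ≤ m := by omega
    have hms : m ≤ s.length := by omega
    rw [EdgeLt.of_gt (by omega), hslq m hms, hq, dir_cons_succ hm]
    have hseg : IsSegment lam (sl s 0 m) := hs.part hm hms
    rcases hms.eq_or_lt with rfl | hlt
    · rw [hd1, sl_length]
      rw [mem_sgn hs] at hmem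
      cases d <;> simp_all
    · have := h m hm hlt
      rw [mem_sgn hseg] at this
      rw [hr, dir_append_left hlt]
      cases d
      · simpa using this
      · cases h' : dir s m <;> simp_all
  obtain ⟨l, r', hp, hc⟩ := hcut.exists_isPath ht2 (by omega)
  refine ⟨l ++ q ++ r', (mem_eta_iff hX).mpr ⟨hp, hc.isCompat hX hp.track ?_⟩, l.length + 1,
    l.length + (s.length + 1), by omega, by omega, ?_, ?_, ?_, ?_⟩
  · simp; omega
  · simp; omega
  · rw [List.append_assoc, sl_append_right, sl_append_left (by omega), hslq _ le_rfl, sl_length]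
  · rw [List.append_assoc, dir_append_right le_rfl, dir_append_left (by omega), hd2]
  · rw [List.append_assoc, dir_append_right (by omega), dir_append_left (by omega),
      hq, dir_cons_succ hpos, hd1]

/-- The converse of `subs_subset_of_mem_cl`. -/
theorem mem_cl_of_subs_subset {lam : Finset Vertex} {X : Set (List Vertex)} (hX : IsBiclosed lam X)
    {d : Bool} {s : List Vertex} (hs : IsSegment lam s) (h : subs d s ⊆ sgn lam d X) :
    s ∈ cl lam (allBends d (eta lam X)) := by
  classical
  have hX' := hX.signed d
  induction hn : s.length using Nat.strong_induction_on generalizing s with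
  | _ n ih =>
    subst hn
    -- Such an `m` is an obstruction to `s` being itself a bend. At the least one, `s` is cut into
    -- two pieces to which induction applies.
    by_cases hex : ∃ m, (1 ≤ m ∧ m < s.length) ∧ dir s m = d ∧ sl s 0 m ∈ sgn lam d X
    · obtain ⟨⟨hm1, hm2⟩, hd, hmem⟩ := Nat.find_spec hex
      have hmin := fun k (hk : k < Nat.find hex) => Nat.find_min hex hk
      set m := Nat.find hex
      have e : s = sl s 0 m ++ sl s m s.length := by
        rw [sl_append (Nat.zero_le _) hm2.le, sl_length]
      have h1 : sl s 0 m ∈ cl lam (allBends d (eta lam X)) := by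
        refine ih _ ?_ (hs.part hm1 hm2.le) ?_ rfl
        · rw [length_sl hm2.le]; omega
        · rintro t ⟨a, b, hab, hb, rfl, ha, hb'⟩
          rw [length_sl hm2.le, Nat.sub_zero] at hb hb'
          rw [sl_sl (by omega), Nat.zero_add, Nat.zero_add]
          have ha' : a = 0 ∨ dir s a = d := by
            rcases Nat.eq_zero_or_pos a with h | hpos
            · exact Or.inl h
            · rw [dir_sl hpos (by omega), Nat.zero_add] at ha; exact ha
          rcases hb.eq_or_lt with rfl | hlt
          · rcases Nat.eq_zero_or_pos a with rfl | hpos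
            · exact hmem
            · refine (hX'.sl_split hpos hab hm2.le hmem).resolve_left fun hc => ?_
              exact hmin a hab ⟨⟨hpos, by omega⟩, ha'.resolve_left (by omega), hc⟩
          · refine h ⟨a, b, hab, by omega, rfl, ha', Or.inr ?_⟩
            have := hb'.resolve_left (by omega)
            rwa [dir_sl (by omega) (by omega), Nat.zero_add] at this
      have h2 : sl s m s.length ∈ cl lam (allBends d (eta lam X)) := by
        refine ih _ ?_ (hs.part hm2 le_rfl) ?_ rfl
        · rw [length_sl le_rfl]; omega
        · rintro t ⟨a, b, hab, hb, rfl, ha, hb'⟩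
          rw [length_sl le_rfl] at hb hb'
          rw [sl_sl (by omega)]
          refine h ⟨m + a, m + b, by omega, by omega, rfl, Or.inr ?_, ?_⟩
          · rcases Nat.eq_zero_or_pos a with rfl | hpos
            · exact hd
            · have := ha.resolve_left (by omega)
              rwa [dir_sl hpos (by omega)] at this
          · rcases hb.eq_or_lt with rfl | hlt
            · left; omega
            · have := hb'.resolve_left (by omega)
              rw [dir_sl (by omega) (by omega)] at this
              exact Or.inr this
      rw [e]
      exact Cl.comp h1 h2 (e ▸ hs)
    · refine subset_cl (mem_allBends_eta hX hs (fun m h1 h2 => ⟨fun hd hc => ?_, fun hc => ?_⟩)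
        (h (self_mem_subs hs.1.1)))
      · exact hex ⟨m, ⟨h1, h2⟩, hd, hc⟩
      · by_contra hd
        exact hc (h ⟨0, m, h1, h2.le, rfl, Or.inl rfl, Or.inr (by cases d <;> simpa using hd)⟩)

theorem isSWSubsegment_iff {s t : List Vertex} (hs : IsWalk s) :
    IsSWSubsegment t s ↔ t ∈ subs true s := by
  have hpre : ∀ {i j}, i < j → j ≤ s.length → (sl s i j <+: s ↔ i = 0) := by
    intro i j hij hj
    constructor
    · intro h
      have h' := List.prefix_iff_eq_take.mp h
      have e : sl s i j = sl s 0 (j - i) := by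
        rw [length_sl hj] at h'
        simpa [sl] using h'
      exact (hs.sl_injective hij hj (by omega) (by omega) e).1
    · rintro rfl
      simpa [sl] using List.take_prefix j s
  have hsuf : ∀ {i j}, i < j → j ≤ s.length → (sl s i j <:+ s ↔ j = s.length) := by
    intro i j hij hj
    constructor
    · intro h
      have h' := List.suffix_iff_eq_drop.mp h
      have e : sl s i j = sl s (s.length - (j - i)) s.length := by
        rw [length_sl hj] at h'
        simpa [sl] using h'
      exact (hs.sl_injective hij hj (by omega) le_rfl e).2
    · rintro rfl
      simpa [sl] using List.drop_suffix i s
  constructor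
  · rintro ⟨hne, hin, h1, h2⟩
    obtain ⟨i, j, hij, hj, rfl⟩ := infix_iff_sl.mp hin
    have hpos := List.length_pos_iff.mpr hne
    rw [length_sl hj] at hpos
    have hij : i < j := by omega
    refine ⟨i, j, hij, hj, rfl, ?_, ?_⟩
    · exact h1.imp (hpre hij hj).mp fun h => ((hs.enters_iff hij hj true).mp h).2
    · exact h2.imp (hsuf hij hj).mp fun h => ((hs.leaves_iff hij hj false).mp h).2
  · rintro ⟨i, j, hij, hj, rfl, h1, h2⟩
    refine ⟨sl_ne_nil hij hj, infix_iff_sl.mpr ⟨i, j, hij.le, hj, rfl⟩, ?_, ?_⟩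
    · by_cases h : i = 0
      · exact Or.inl ((hpre hij hj).mpr h)
      · exact Or.inr ((hs.enters_iff hij hj true).mpr ⟨by omega, h1.resolve_left h⟩)
    · by_cases h : j = s.length
      · exact Or.inl ((hsuf hij hj).mpr h)
      · exact Or.inr ((hs.leaves_iff hij hj false).mpr ⟨by omega, h2.resolve_left h⟩)

theorem down_eq_cl {lam : Finset Vertex} {X : Set (List Vertex)} (hX : IsBiclosed lam X) :
    down X = cl lam (allBends true (eta lam X)) := by
  ext s
  constructor
  · rintro ⟨hs, h⟩
    have hseg : IsSegment lam s := hX.1 hs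
    exact mem_cl_of_subs_subset hX hseg fun t ht => h t ((isSWSubsegment_iff hseg.1).mpr ht)
  · intro hs
    have hseg : IsSegment lam s := (isBiclosed_cl_allBends (eta_isPath hX) true).1 hs
    have h := subs_subset_of_mem_cl hX hs
    exact ⟨h (self_mem_subs hseg.1.1), fun t ht => h ((isSWSubsegment_iff hseg.1).mp ht)⟩

/-! ### Facets -/

theorem isFace_eta {lam : Finset Vertex} {X : Set (List Vertex)} (hX : IsBiclosed lam X) :
    IsFace lam (eta lam X) := by
  refine ⟨eta_isPath hX, fun p hp q hq hk => ?_⟩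
  have hpp := eta_isPath hX p hp
  obtain ⟨d, s, h1, h2⟩ := (kissing_iff hpp.1 (eta_isPath hX q hq).1).mp hk
  have h1' := ((mem_eta_iff_bends hX).mp hp).2 (!d) h1
  have h2' := ((mem_eta_iff_bends hX).mp hq).2 d h2
  exact (sgn_not (hpp.track.isSegment_of_mem_bends h1)).mp h1' h2'

/-- Consider a shortest bend of `q` of the wrong sign. As shorter bends have the right sign, all its
subsegments of the opposite kind have the opposite sign, so it lies in the closure of the opposite
bends of η(X). Then `q` kisses some path of η(X). -/
theorem mem_eta_of_not_kissing {lam : Finset Vertex} {X : Set (List Vertex)}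
    (hX : IsBiclosed lam X) {q : List Vertex} (hq : IsPath lam q)
    (hk : ∀ p ∈ eta lam X, ¬ Kissing p q) : q ∈ eta lam X := by
  refine (mem_eta_iff_bends hX).mpr ⟨hq, ?_⟩
  have key : ∀ n d i j, j - i = n → 1 ≤ i → i < j → j < q.length → dir q i = d → dir q j = (!d) →
      sl q i j ∈ sgn lam d X := by
    intro n
    induction n using Nat.strong_induction_on with
    | _ n ih =>
      intro d i j hn hi hij hj h1 h2
      by_contra hnot
      have hseg := hq.track.isSegment hi hij hj
      have hmem := (sgn_not hseg).mpr hnot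
      have hX' := hX.signed (!d)
      have hc : sl q i j ∈ cl lam (allBends (!d) (eta lam X)) := by
        refine mem_cl_of_subs_subset hX hseg ?_
        rintro t ⟨a, b, hab, hb, rfl, ha, hb'⟩
        rw [length_sl hj.le] at hb hb'
        rw [sl_sl (by omega)]
        have ha' : 1 ≤ a → dir q (i + a) = !d := fun hpos => by
          have := ha.resolve_left (by omega)
          rwa [dir_sl hpos (by omega)] at this
        have hb'' : b < j - i → dir q (i + b) = d := fun hlt => by
          have := hb'.resolve_left (by omega)
          rwa [dir_sl (by omega) (by omega), Bool.not_not] at this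
        have hb0 : b = j - i → i + b = j := fun h => by omega
        rcases Nat.eq_zero_or_pos a with rfl | hpos
        · rcases hb.eq_or_lt with h | hlt
          · rw [hb0 h]; exact hmem
          -- An initial piece of the wrong bend: the rest is a shorter bend of kind `d`, which has
          -- the right sign, so the piece carries the opposite one.
          · refine (hX'.sl_split (j := i + b) (by omega) (by omega) hj.le hmem).resolve_right ?_
            rw [sgn_not (hq.track.isSegment (by omega) (by omega) hj), not_not]
            exact ih (j - (i + b)) (by omega) d (i + b) j rfl (by omega) (by omega) hj
              (hb'' hlt) h2
        · rcases hb.eq_or_lt with h | hlt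
          · rw [hb0 h]
            refine (hX'.sl_split (j := i + a) (by omega) (by omega) hj.le hmem).resolve_left ?_
            rw [sgn_not (hq.track.isSegment hi (by omega) (by omega)), not_not]
            exact ih (i + a - i) (by omega) d i (i + a) rfl hi (by omega) (by omega) h1
              (ha' hpos)
          · exact ih (i + b - (i + a)) (by omega) (!d) (i + a) (i + b) rfl (by omega) (by omega)
              (by omega) (ha' hpos) (by rw [Bool.not_not]; exact hb'' hlt)
      refine not_mem_bends_of_mem_cl (eta_isPath hX) hq hk hc ?_
      rw [Bool.not_not]
      exact ⟨i, j, hi, hij, hj, rfl, h1, h2⟩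
  rintro d s ⟨i, j, hi, hij, hj, rfl, h1, h2⟩
  exact key _ d i j rfl hi hij hj h1 h2

theorem maximal_eta {lam : Finset Vertex} {X : Set (List Vertex)} (hX : IsBiclosed lam X) :
    Maximal (IsFace lam) (eta lam X) :=
  ⟨isFace_eta hX, fun _ hF hsub q hq =>
    mem_eta_of_not_kissing hX (hF.1 q hq) fun p hp => hF.2 p (hsub hp) q hq⟩

theorem subset_eta {lam : Finset Vertex} {X F : Set (List Vertex)} (hX : IsBiclosed lam X)
    (hF : ∀ p ∈ F, IsPath lam p) (h : ∀ d, allBends d F ⊆ sgn lam d X) : F ⊆ eta lam X :=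
  fun p hp => (mem_eta_iff_bends hX).mpr ⟨hF p hp, fun d _ hs => h d ⟨p, hp, hs⟩⟩

theorem allBends_subset {lam : Finset Vertex} {X F : Set (List Vertex)} (hX : IsBiclosed lam X)
    (h : F ⊆ eta lam X) (d : Bool) : allBends d F ⊆ sgn lam d X := by
  rintro s ⟨p, hp, hs⟩
  exact ((mem_eta_iff_bends hX).mp (h hp)).2 d hs

/-! ### The fibers of `η` -/

/-- The smallest biclosed set `X` such that `F ⊆ η(X)`. -/
def lo (lam : Finset Vertex) (F : Set (List Vertex)) : Set (List Vertex) :=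
  cl lam (allBends true F)

/-- The largest biclosed set `X` such that `F ⊆ η(X)`. -/
def hi (lam : Finset Vertex) (F : Set (List Vertex)) : Set (List Vertex) :=
  {s | IsSegment lam s} \ cl lam (allBends false F)

section Fibers

variable {lam : Finset Vertex} {X Y F G : Set (List Vertex)}

theorem isBiclosed_lo (hF : ∀ p ∈ F, IsPath lam p) : IsBiclosed lam (lo lam F) :=
  isBiclosed_cl_allBends hF true

theorem isBiclosed_hi (hF : ∀ p ∈ F, IsPath lam p) : IsBiclosed lam (hi lam F) :=
  (isBiclosed_cl_allBends hF false).compl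

theorem allBends_mono (d : Bool) (h : F ⊆ G) : allBends d F ⊆ allBends d G :=
  fun _ ⟨p, hp, hs⟩ => ⟨p, h hp, hs⟩

theorem lo_mono (h : F ⊆ G) : lo lam F ⊆ lo lam G := cl_mono (allBends_mono true h)

theorem hi_anti (h : F ⊆ G) : hi lam G ⊆ hi lam F :=
  Set.sdiff_subset_sdiff_right (cl_mono (allBends_mono false h))

theorem subset_eta_iff (hX : IsBiclosed lam X) (hF : ∀ p ∈ F, IsPath lam p) :
    F ⊆ eta lam X ↔ lo lam F ⊆ X ∧ X ⊆ hi lam F := by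
  constructor
  · intro h
    refine ⟨cl_subset hX.2.1 (allBends_subset hX h true), fun s hs => ⟨hX.1 hs, fun hc => ?_⟩⟩
    exact (cl_subset hX.compl.2.1 (allBends_subset hX h false) hc).2 hs
  · rintro ⟨h1, h2⟩
    refine subset_eta hX hF fun d => ?_
    cases d
    · rintro s ⟨p, hp, hs⟩
      refine ⟨(hF p hp).track.isSegment_of_mem_bends hs, fun hsX => ?_⟩
      exact (h2 hsX).2 (subset_cl ⟨p, hp, hs⟩)
    · exact subset_cl.trans h1

/-- The complement of the lower bound is closed and, since no two paths of F kiss, contains the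
bends of the other kind; hence it contains their closure. -/
theorem IsFace.lo_subset_hi (hF : IsFace lam F) : lo lam F ⊆ hi lam F := by
  have hB := isBiclosed_lo hF.1
  refine fun s hs => ⟨hB.1 hs, fun hc => ?_⟩
  refine (cl_subset hB.compl.2.1 ?_ hc).2 hs
  rintro t ⟨q, hq, ht⟩
  refine ⟨(hF.1 q hq).track.isSegment_of_mem_bends ht, fun h => ?_⟩
  exact not_mem_bends_of_mem_cl hF.1 (hF.1 q hq) (fun p hp => hF.2 p hp q hq) h ht

theorem IsFace.subset_eta_lo (hF : IsFace lam F) : F ⊆ eta lam (lo lam F) :=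
  (subset_eta_iff (isBiclosed_lo hF.1) hF.1).mpr ⟨subset_rfl, hF.lo_subset_hi⟩

theorem IsFace.subset_eta_hi (hF : IsFace lam F) : F ⊆ eta lam (hi lam F) :=
  (subset_eta_iff (isBiclosed_hi hF.1) hF.1).mpr ⟨hF.lo_subset_hi, subset_rfl⟩

theorem eq_of_subset_eta (hF : Maximal (IsFace lam) F) (hX : IsBiclosed lam X)
    (h : F ⊆ eta lam X) : eta lam X = F :=
  (hF.eq_of_subset (isFace_eta hX) h).symm

theorem eta_lo (hF : Maximal (IsFace lam) F) : eta lam (lo lam F) = F :=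
  eq_of_subset_eta hF (isBiclosed_lo hF.prop.1) hF.prop.subset_eta_lo

theorem eta_hi (hF : Maximal (IsFace lam) F) : eta lam (hi lam F) = F :=
  eq_of_subset_eta hF (isBiclosed_hi hF.prop.1) hF.prop.subset_eta_hi

theorem eta_eq_iff (hF : Maximal (IsFace lam) F) (hX : IsBiclosed lam X) :
    eta lam X = F ↔ lo lam F ⊆ X ∧ X ⊆ hi lam F := by
  rw [← subset_eta_iff hX hF.prop.1]
  exact ⟨fun h => h.symm.subset, eq_of_subset_eta hF hX⟩

theorem lo_eta_subset (hX : IsBiclosed lam X) : lo lam (eta lam X) ⊆ X :=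
  ((eta_eq_iff (maximal_eta hX) hX).mp rfl).1

theorem subset_hi_eta (hX : IsBiclosed lam X) : X ⊆ hi lam (eta lam X) :=
  ((eta_eq_iff (maximal_eta hX) hX).mp rfl).2

/-- Membership in the left side means that all SW-subsegments are in X, a condition that is monotone
in X. -/
theorem lo_eta_mono (hX : IsBiclosed lam X) (hY : IsBiclosed lam Y) (h : X ⊆ Y) :
    lo lam (eta lam X) ⊆ lo lam (eta lam Y) := by
  intro s hs
  have hseg := (isBiclosed_lo (eta_isPath hX)).1 hs
  exact mem_cl_of_subs_subset hY hseg ((subs_subset_of_mem_cl hX hs).trans h)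

theorem hi_eta_mono (hX : IsBiclosed lam X) (hY : IsBiclosed lam Y) (h : X ⊆ Y) :
    hi lam (eta lam X) ⊆ hi lam (eta lam Y) := by
  rintro s ⟨hseg, hs⟩
  refine ⟨hseg, fun hc => hs ?_⟩
  exact mem_cl_of_subs_subset hX hseg
    ((subs_subset_of_mem_cl hY hc).trans (Set.sdiff_subset_sdiff_right h))

theorem down_eq_lo (hX : IsBiclosed lam X) : down X = lo lam (eta lam X) := down_eq_cl hX

theorem isBiclosed_down (hX : IsBiclosed lam X) : IsBiclosed lam (down X) := by
  rw [down_eq_lo hX]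
  exact isBiclosed_lo (eta_isPath hX)

theorem eta_down (hX : IsBiclosed lam X) : eta lam (down X) = eta lam X := by
  rw [down_eq_lo hX, eta_lo (maximal_eta hX)]

theorem eta_eq_eta_iff (hX : IsBiclosed lam X) (hY : IsBiclosed lam Y) :
    eta lam X = eta lam Y ↔ down X = down Y := by
  constructor
  · intro h
    rw [down_eq_lo hX, down_eq_lo hY, h]
  · intro h
    rw [← eta_down hX, h, eta_down hY]

theorem hi_eta_mono_of_down (hX : IsBiclosed lam X) (hY : IsBiclosed lam Y)
    (h : down X ⊆ down Y) : hi lam (eta lam X) ⊆ hi lam (eta lam Y) := by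
  rw [← eta_down hX, ← eta_down hY]
  exact hi_eta_mono (isBiclosed_down hX) (isBiclosed_down hY) h

/-! ### The lattice of biclosed sets -/

theorem isBiclosed_cl_union (hX : IsBiclosed lam X) (hY : IsBiclosed lam Y) :
    IsBiclosed lam (cl lam (X ∪ Y)) := by
  refine isBiclosed_cl (fun s hs => hs.elim (fun h => hX.1 h) fun h => hY.1 h) ?_
  rintro a b ha hb (h | h)
  · exact (hX.split ha hb h).imp (fun h => subset_cl (Or.inl h)) fun h => subset_cl (Or.inl h)
  · exact (hY.split ha hb h).imp (fun h => subset_cl (Or.inr h)) fun h => subset_cl (Or.inr h)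

/-- The lattice of biclosed sets, ordered by inclusion. -/
@[reducible] def bicLattice (lam : Finset Vertex) : Lattice (Bic lam) where
  le X Y := X.1 ⊆ Y.1
  le_refl X := subset_rfl
  le_trans X Y Z h1 h2 := h1.trans h2
  le_antisymm X Y h1 h2 := Subtype.ext (h1.antisymm h2)
  sup X Y := ⟨cl lam (X.1 ∪ Y.1), isBiclosed_cl_union X.2 Y.2⟩
  inf X Y := ⟨{s | IsSegment lam s} \
    cl lam (({s | IsSegment lam s} \ X.1) ∪ ({s | IsSegment lam s} \ Y.1)),
    (isBiclosed_cl_union X.2.compl Y.2.compl).compl⟩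
  le_sup_left X Y := Set.subset_union_left.trans subset_cl
  le_sup_right X Y := Set.subset_union_right.trans subset_cl
  sup_le X Y Z h1 h2 := cl_subset Z.2.2.1 (Set.union_subset h1 h2)
  inf_le_left X Y := by
    rintro s ⟨hs, h⟩
    by_contra hc
    exact h (subset_cl (Or.inl ⟨hs, hc⟩))
  inf_le_right X Y := by
    rintro s ⟨hs, h⟩
    by_contra hc
    exact h (subset_cl (Or.inr ⟨hs, hc⟩))
  le_inf X Y Z h1 h2 := by
    intro s hs
    refine ⟨X.2.1 hs, fun hc => ?_⟩
    exact (cl_subset X.2.compl.2.1 (Set.union_subset (Set.sdiff_subset_sdiff_right h1)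
      (Set.sdiff_subset_sdiff_right h2)) hc).2 hs

theorem eta_eq_of_between {Z : Set (List Vertex)} (hX : IsBiclosed lam X) (hZ : IsBiclosed lam Z)
    (h1 : lo lam (eta lam X) ⊆ Z) (h2 : Z ⊆ hi lam (eta lam X)) : eta lam Z = eta lam X :=
  (eta_eq_iff (maximal_eta hX) hZ).mpr ⟨h1, h2⟩

/-- The smallest biclosed set with the same image under `η`. -/
def lower (X : Bic lam) : Bic lam := ⟨lo lam (eta lam X.1), isBiclosed_lo (eta_isPath X.2)⟩

/-- The largest biclosed set with the same image under `η`. -/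
def upper (X : Bic lam) : Bic lam := ⟨hi lam (eta lam X.1), isBiclosed_hi (eta_isPath X.2)⟩

theorem lower_congr {X Y : Bic lam} (h : eta lam X.1 = eta lam Y.1) : lower X = lower Y :=
  Subtype.ext (by simp only [lower, h])

theorem upper_congr {X Y : Bic lam} (h : eta lam X.1 = eta lam Y.1) : upper X = upper Y :=
  Subtype.ext (by simp only [upper, h])

theorem eta_lower (X : Bic lam) : eta lam (lower X).1 = eta lam X.1 := eta_lo (maximal_eta X.2)

theorem eta_upper (X : Bic lam) : eta lam (upper X).1 = eta lam X.1 := eta_hi (maximal_eta X.2)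

/-- It suffices to replace X and Y by the bottoms A, B of their fibers. Monotonicity of the tops
puts X and Y below the top of the fiber of A ⊔ B, so X ⊔ Y lies in that fiber. -/
theorem eta_sup_congr (X Y X' Y' : Bic lam) (hX : eta lam X.1 = eta lam X'.1)
    (hY : eta lam Y.1 = eta lam Y'.1) :
    letI := bicLattice lam
    eta lam (X ⊔ Y).1 = eta lam (X' ⊔ Y').1 := by
  let := bicLattice lam
  have key : ∀ X Y : Bic lam, eta lam (X ⊔ Y).1 = eta lam (lower X ⊔ lower Y).1 := by
    intro X Y
    set A := lower X
    set B := lower Y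
    have hA : eta lam A.1 = eta lam X.1 := eta_lower X
    have hB : eta lam B.1 = eta lam Y.1 := eta_lower Y
    have hAX : A ≤ X := lo_eta_subset X.2
    have hBY : B ≤ Y := lo_eta_subset Y.2
    refine eta_eq_of_between (A ⊔ B).2 (X ⊔ Y).2 ?_ ?_
    · exact (lo_eta_subset (A ⊔ B).2).trans (sup_le_sup hAX hBY : A ⊔ B ≤ X ⊔ Y)
    · refine (sup_le ?_ ?_ : X ⊔ Y ≤ upper (A ⊔ B))
      · refine (subset_hi_eta X.2).trans ?_
        rw [← hA]
        exact hi_eta_mono A.2 (A ⊔ B).2 (le_sup_left : A ≤ A ⊔ B)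
      · refine (subset_hi_eta Y.2).trans ?_
        rw [← hB]
        exact hi_eta_mono B.2 (A ⊔ B).2 (le_sup_right : B ≤ A ⊔ B)
  rw [key X Y, key X' Y', lower_congr hX, lower_congr hY]

theorem eta_inf_congr (X Y X' Y' : Bic lam) (hX : eta lam X.1 = eta lam X'.1)
    (hY : eta lam Y.1 = eta lam Y'.1) :
    letI := bicLattice lam
    eta lam (X ⊓ Y).1 = eta lam (X' ⊓ Y').1 := by
  let := bicLattice lam
  have key : ∀ X Y : Bic lam, eta lam (X ⊓ Y).1 = eta lam (upper X ⊓ upper Y).1 := by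
    intro X Y
    set A := upper X
    set B := upper Y
    have hA : eta lam A.1 = eta lam X.1 := eta_upper X
    have hB : eta lam B.1 = eta lam Y.1 := eta_upper Y
    have hAX : X ≤ A := subset_hi_eta X.2
    have hBY : Y ≤ B := subset_hi_eta Y.2
    refine eta_eq_of_between (A ⊓ B).2 (X ⊓ Y).2 ?_ ?_
    · refine (le_inf ?_ ?_ : lower (A ⊓ B) ≤ X ⊓ Y)
      · refine Set.Subset.trans ?_ (lo_eta_subset X.2)
        rw [← hA]
        exact lo_eta_mono (A ⊓ B).2 A.2 (inf_le_left : A ⊓ B ≤ A)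
      · refine Set.Subset.trans ?_ (lo_eta_subset Y.2)
        rw [← hB]
        exact lo_eta_mono (A ⊓ B).2 B.2 (inf_le_right : A ⊓ B ≤ B)
    · exact Set.Subset.trans (inf_le_inf hAX hBY : X ⊓ Y ≤ A ⊓ B) (subset_hi_eta (A ⊓ B).2)
  rw [key X Y, key X' Y', upper_congr hX, upper_congr hY]

/-- The congruence `X↓ = Y↓`. -/
def downCon (lam : Finset Vertex) : @LatticeCon (Bic lam) (bicLattice lam) :=
  letI := bicLattice lam
  { r := fun X Y => down X.1 = down Y.1
    iseqv := ⟨fun _ => rfl, fun h => h.symm, fun h1 h2 => h1.trans h2⟩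
    inf := fun {w x y z} h1 h2 => (eta_eq_eta_iff (w ⊓ y).2 (x ⊓ z).2).mp
      (eta_inf_congr w y x z ((eta_eq_eta_iff w.2 x.2).mpr h1) ((eta_eq_eta_iff y.2 z.2).mpr h2))
    sup := fun {w x y z} h1 h2 => (eta_eq_eta_iff (w ⊔ y).2 (x ⊔ z).2).mp
      (eta_sup_congr w y x z ((eta_eq_eta_iff w.2 x.2).mpr h1) ((eta_eq_eta_iff y.2 z.2).mpr h2)) }

theorem cls_le_cls_iff (X Y : Bic lam) :
    letI := bicLattice lam
    cls (downCon lam) X ≤ cls (downCon lam) Y ↔ down X.1 ⊆ down Y.1 := by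
  let := bicLattice lam
  have h : cls (downCon lam) X ≤ cls (downCon lam) Y ↔ down (X ⊔ Y).1 = down Y.1 := by
    rw [← sup_eq_right]
    exact Quotient.eq (r := (downCon lam).toSetoid) (x := X ⊔ Y) (y := Y)
  rw [h]
  constructor
  · intro h
    rw [← h, down_eq_lo X.2, down_eq_lo (X ⊔ Y).2]
    exact lo_eta_mono X.2 (X ⊔ Y).2 (le_sup_left : X ≤ X ⊔ Y)
  · intro h
    set D : Bic lam := ⟨down X.1, isBiclosed_down X.2⟩
    have hD : D ≤ Y := by
      refine Set.Subset.trans h ?_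
      rw [down_eq_lo Y.2]
      exact lo_eta_subset Y.2
    rw [← eta_eq_eta_iff (X ⊔ Y).2 Y.2, eta_sup_congr X Y D Y (eta_down X.2).symm rfl,
      sup_eq_right.mpr hD]

/-! ### Adding a segment to a biclosed set -/

theorem IsWalk.not_append_self {s : List Vertex} (h : s ≠ []) : ¬ IsWalk (s ++ s) := by
  intro hw
  have := hw.nodup
  rw [List.nodup_append'] at this
  obtain ⟨a, ha⟩ := List.exists_mem_of_ne_nil s h
  exact this.2.2 ha ha

/-- Call a segment of Y \ X addable if each of its splittings has a part in X, so that adding it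
keeps the complement closed. A shortest segment of Y \ X is addable, and adding a longest addable
segment also keeps X closed. -/
theorem exists_isBiclosed_insert (hX : IsBiclosed lam X) (hY : IsBiclosed lam Y) (h : X ⊆ Y)
    (hne : X ≠ Y) : ∃ s, s ∈ Y ∧ s ∉ X ∧ IsBiclosed lam (insert s X) := by
  let T : Set (List Vertex) :=
    {s | s ∈ Y ∧ s ∉ X ∧ ∀ a b, a ≠ [] → b ≠ [] → s = a ++ b → a ∈ X ∨ b ∈ X}
  have hfin : (Y \ X).Finite := (finite_segments lam).subset fun s hs => hY.1 hs.1
  have hTne : T.Nonempty := by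
    obtain ⟨s, hs, hmin⟩ := Set.exists_min_image (Y \ X) List.length hfin
      (by rw [Set.sdiff_nonempty]; exact fun h' => hne (h.antisymm h'))
    refine ⟨s, hs.1, hs.2, ?_⟩
    rintro a b ha hb rfl
    have ha' := List.length_pos_iff.mpr ha
    have hb' := List.length_pos_iff.mpr hb
    have hshort : ∀ t ∈ Y, t.length < (a ++ b).length → t ∈ X := fun t ht hl => by
      by_contra hc
      exact absurd (hmin t ⟨ht, hc⟩) (by omega)
    exact (hY.split ha hb hs.1).imp (fun h => hshort a h (by simp; omega))
      fun h => hshort b h (by simp; omega)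
  obtain ⟨s, ⟨hsY, hsX, hsplit⟩, hmax⟩ := Set.exists_max_image T List.length
    (hfin.subset fun s hs => ⟨hs.1, hs.2.1⟩) hTne
  have hseg : IsSegment lam s := hY.1 hsY
  -- If the composite were not in X it would again be addable, contradicting the maximal length of
  -- `s`. Induction on `t` treats splittings inside `t`.
  have hright : ∀ t ∈ X, IsSegment lam (s ++ t) → s ++ t ∈ X := by
    intro t
    induction hn : t.length using Nat.strong_induction_on generalizing t with
    | _ n ih =>
      subst hn
      intro ht hst
      by_contra hc
      have htl := (hX.1 ht).length_pos
      have hT : s ++ t ∈ T := by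
        refine ⟨hY.2.1 s hsY t (h ht) hst, hc, fun a b ha hb hab => ?_⟩
        have hseg' : IsSegment lam (a ++ b) := hab ▸ hst
        have hb' := List.length_pos_iff.mpr hb
        rcases List.append_eq_append_iff.mp hab with ⟨z, rfl, rfl⟩ | ⟨z, rfl, rfl⟩
        · by_cases hz : z = []
          · subst hz; right; simpa using ht
          · refine (hX.split hz hb ht).imp_left fun hzX => ?_
            exact ih z.length (by simp; omega) z rfl hzX (hseg'.append_left ha)
        · by_cases hz : z = []
          · subst hz; right; simpa using ht
          · refine (hsplit a z ha hz rfl).imp_right fun hzX => ?_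
            exact hX.2.1 z hzX t ht (hseg'.append_right hb)
      have := hmax _ hT
      rw [List.length_append] at this
      omega
  have hleft : ∀ t ∈ X, IsSegment lam (t ++ s) → t ++ s ∈ X := by
    intro t
    induction hn : t.length using Nat.strong_induction_on generalizing t with
    | _ n ih =>
      subst hn
      intro ht hst
      by_contra hc
      have htl := (hX.1 ht).length_pos
      have hT : t ++ s ∈ T := by
        refine ⟨hY.2.1 t (h ht) s hsY hst, hc, fun a b ha hb hab => ?_⟩
        have hseg' : IsSegment lam (a ++ b) := hab ▸ hst
        have ha' := List.length_pos_iff.mpr ha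
        rcases List.append_eq_append_iff.mp hab with ⟨z, rfl, rfl⟩ | ⟨z, rfl, rfl⟩
        · by_cases hz : z = []
          · subst hz; left; simpa using ht
          · refine (hsplit z b hz hb rfl).imp_left fun hzX => ?_
            exact hX.2.1 t ht z hzX (hseg'.append_left ha)
        · by_cases hz : z = []
          · subst hz; left; simpa using ht
          · refine (hX.split ha hz ht).imp_right fun hzX => ?_
            exact ih z.length (by simp; omega) z rfl hzX (hseg'.append_right hb)
      have := hmax _ hT
      rw [List.length_append] at this
      omega
  refine ⟨s, hsY, hsX, ?_, ?_, ?_⟩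
  · rintro t (rfl | ht)
    · exact hseg
    · exact hX.1 ht
  · rintro a (rfl | ha) b (rfl | hb) hab
    · exact absurd hab.1 (IsWalk.not_append_self hseg.1.1)
    · exact Or.inr (hright b hb hab)
    · exact Or.inr (hleft a ha hab)
    · exact Or.inr (hX.2.1 a ha b hb hab)
  · rintro a ⟨ha, ha'⟩ b ⟨hb, hb'⟩ hab
    refine ⟨hab, ?_⟩
    have ha2 : a ∉ X := fun h => ha' (Or.inr h)
    have hb2 : b ∉ X := fun h => hb' (Or.inr h)
    rintro (hs | hmem)
    · exact (hsplit a b ha.1.1 hb.1.1 hs.symm).elim ha2 hb2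
    · exact (hX.split ha.1.1 hb.1.1 hmem).elim ha2 hb2

theorem exists_isBiclosed_diff (hX : IsBiclosed lam X) (hY : IsBiclosed lam Y) (h : X ⊆ Y)
    (hne : X ≠ Y) : ∃ s, s ∈ Y ∧ s ∉ X ∧ IsBiclosed lam (Y \ {s}) := by
  obtain ⟨s, hs1, hs2, hB⟩ := exists_isBiclosed_insert hY.compl hX.compl
    (Set.sdiff_subset_sdiff_right h) (fun e => hne (by
      rw [← Set.sdiff_sdiff_cancel_left hX.1, ← Set.sdiff_sdiff_cancel_left hY.1, e]))
  refine ⟨s, ?_, hs1.2, ?_⟩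
  · by_contra hc
    exact hs2 ⟨hs1.1, hc⟩
  · convert hB.compl using 1
    ext t
    constructor
    · rintro ⟨ht, hts⟩
      refine ⟨hY.1 ht, ?_⟩
      rintro (rfl | h')
      · exact hts rfl
      · exact h'.2 ht
    · rintro ⟨ht, hts⟩
      refine ⟨?_, fun h' => hts (Or.inl h')⟩
      by_contra hc
      exact hts (Or.inr ⟨ht, hc⟩)

end Fibers

/-! ### Flips -/

section Flips

variable {lam : Finset Vertex} {X Y A B F : Set (List Vertex)} {p q s : List Vertex} {d : Bool}

/-- The orders of A and B differ only in the pair `i`, `j`, so these two are neighbors in either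
order. Hence `i` is the least vertical edge for A and `j` the greatest horizontal one. -/
theorem isCut_of_reversed (hB : IsBiclosed lam B) (hp : IsTrack lam p)
    (hc : IsCompat A p) {i j : ℕ} (hi : 1 ≤ i ∧ i < p.length) (hj : 1 ≤ j ∧ j < p.length)
    (hdi : dir p i = true) (hdj : dir p j = false) (hrev : EdgeLt B p i j)
    (hAB : ∀ k l, 1 ≤ k ∧ k < p.length → 1 ≤ l ∧ l < p.length → ¬ (k = i ∧ l = j) →
      ¬ (k = j ∧ l = i) → (EdgeLt A p k l ↔ EdgeLt B p k l)) : IsCut A p i ∧ IsCut A p j := by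
  have hne : ∀ {k l}, dir p k = true → dir p l = false → k ≠ l := by
    rintro k l h1 h2 rfl; simp [h1] at h2
  constructor
  · intro k hk hki
    cases hdk : dir p k
    · simpa using hc k i hk hi hdk hdi
    · simp only [Bool.true_eq_false, false_iff]
      have h1 := (hAB j k hj hk (fun h => hne hdi hdj h.1.symm) (fun h => hki h.2)).mp (hc j k hj hk hdj hdk)
      have h2 := hrev.trans hB hp hi hj hk h1
      have h3 := hne hdk hdj
      have h4 := hne hdi hdj
      exact ((hAB i k hi hk (fun h => h3 h.2) (fun h => h4 h.1)).mpr h2).asymm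
  · intro k hk hkj
    cases hdk : dir p k
    · simp only [true_iff]
      have h1 := (hAB k i hk hi (fun h => hkj (by omega)) (fun h => hkj h.1)).mp
        (hc k i hk hi hdk hdi)
      have h2 := h1.trans hB hp hk hi hj hrev
      have h3 := hne hdi hdk
      exact (hAB k j hk hj (fun h => h3 h.1.symm) (fun h => hkj h.1)).mpr h2
    · simpa using (hc j k hj hk hdj hdk).asymm

theorem exists_isCut_of_bend (hA : IsBiclosed lam A) (hB : IsBiclosed lam B)
    (hAB : ∀ t, t ≠ s → (t ∈ A ↔ t ∈ B)) (hp : p ∈ eta lam A) (hs : s ∈ bends d p)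
    (hsB : s ∉ sgn lam d B) : ∃ i j, 1 ≤ i ∧ i < j ∧ j < p.length ∧ s = sl p i j ∧ dir p i = d ∧
      dir p j = (!d) ∧ IsCut A p i ∧ IsCut A p j := by
  obtain ⟨hpath, hc⟩ := (mem_eta_iff hA).mp hp
  obtain ⟨i, j, hi, hij, hj, rfl, h1, h2⟩ := hs
  have hseg := hpath.track.isSegment hi hij hj
  have hcompare : ∀ k l, 1 ≤ k ∧ k < p.length → 1 ≤ l ∧ l < p.length → ¬ (k = i ∧ l = j) →
      ¬ (k = j ∧ l = i) → (EdgeLt A p k l ↔ EdgeLt B p k l) := by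
    intro k l hk hl hn1 hn2
    rcases lt_trichotomy k l with h | rfl | h
    · rw [EdgeLt.of_lt h, EdgeLt.of_lt h, hAB]
      exact fun e => hn1 (hpath.1.sl_injective h hl.2.le hij hj.le e)
    · simp [EdgeLt]
    · rw [EdgeLt.of_gt h, EdgeLt.of_gt h, hAB]
      exact fun e => hn2 (hpath.1.sl_injective h hk.2.le hij hj.le e).symm
  rw [mem_sgn hseg] at hsB
  refine ⟨i, j, hi, hij, hj, rfl, h1, h2, ?_⟩
  cases d
  · refine (isCut_of_reversed hB hpath.track hc ⟨by omega, hj⟩ ⟨hi, by omega⟩ h2 h1 ?_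
      fun k l hk hl hn1 hn2 => hcompare k l hk hl hn2 hn1).symm
    rw [EdgeLt.of_gt hij]
    simpa using hsB
  · refine isCut_of_reversed hB hpath.track hc ⟨hi, by omega⟩ ⟨by omega, hj⟩ h1 h2 ?_ hcompare
    rw [EdgeLt.of_lt hij]
    simpa using hsB

/-- The edge through which both paths enter `s` is the same edge of the grid and a cut of both, and
a path is determined by a cut. -/
theorem eq_of_bend (hA : IsBiclosed lam A) (hB : IsBiclosed lam B)
    (hAB : ∀ t, t ≠ s → (t ∈ A ↔ t ∈ B)) (hp : p ∈ eta lam A) (hq : q ∈ eta lam A)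
    (hsp : s ∈ bends d p) (hsq : s ∈ bends d q) (hsB : s ∉ sgn lam d B) : p = q := by
  obtain ⟨i, j, hi, hij, hj, e1, h1, -, hc1, -⟩ := exists_isCut_of_bend hA hB hAB hp hsp hsB
  obtain ⟨k, l, hk, hkl, hl, e2, h2, -, hc2, -⟩ := exists_isCut_of_bend hA hB hAB hq hsq hsB
  have hp' := eta_isPath hA p hp
  have hq' := eta_isPath hA q hq
  have e : vx p i = vx q k := by
    have := congrArg (fun t => vx t 0) (e1.symm.trans e2)
    rwa [vx_sl (by omega), vx_sl (by omega)] at this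
  refine IsCut.unique hp' hq' ⟨hi, by omega⟩ ⟨hk, by omega⟩ ?_ e hc1 hc2
  have h3 := hp'.1.vx_succ hi (by omega)
  have h4 := hq'.1.vx_succ hk (by omega)
  rw [h1] at h3
  rw [h2] at h4
  exact stp_injective d (h3.symm.trans (e.trans h4))

theorem mem_bends_of_not_mem_eta (hA : IsBiclosed lam A) (hB : IsBiclosed lam B)
    (hAB : ∀ t, t ≠ s → (t ∈ A ↔ t ∈ B)) (hp : p ∈ eta lam A) (hpB : p ∉ eta lam B) :
    ∃ d, s ∈ bends d p ∧ s ∈ sgn lam d A ∧ s ∉ sgn lam d B := by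
  rw [mem_eta_iff_bends hA] at hp
  rw [mem_eta_iff_bends hB, not_and] at hpB
  have := hpB hp.1
  push Not at this
  obtain ⟨d, hd⟩ := this
  obtain ⟨t, ht, htB⟩ := Set.not_subset.mp hd
  have hseg := hp.1.track.isSegment_of_mem_bends ht
  have htA := hp.2 d ht
  have : t = s := by
    by_contra hne
    rw [mem_sgn hseg] at htA htB
    rw [hAB t hne] at htA
    exact htB htA
  subst this
  exact ⟨d, ht, htA, htB⟩

/-- Removing one segment from a biclosed set changes its image under `η`, if at all, by a flip. -/
theorem flip_eta_diff_singleton (hY : IsBiclosed lam Y) (hsY : s ∈ Y)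
    (hZ : IsBiclosed lam (Y \ {s})) (hne : eta lam (Y \ {s}) ≠ eta lam Y) :
    Flip (eta lam (Y \ {s})) (eta lam Y) := by
  have hseg : IsSegment lam s := hY.1 hsY
  have hYZ : ∀ t, t ≠ s → (t ∈ Y ↔ t ∈ Y \ {s}) := fun t ht => by simp [ht]
  have hY' : ∀ p ∈ eta lam Y \ eta lam (Y \ {s}), s ∈ bends true p := by
    rintro p ⟨h1, h2⟩
    obtain ⟨d, hd, hdA, -⟩ := mem_bends_of_not_mem_eta hY hZ hYZ h1 h2
    rw [mem_sgn hseg] at hdA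
    rwa [hdA.mp hsY] at hd
  have hZ' : ∀ p ∈ eta lam (Y \ {s}) \ eta lam Y, s ∈ bends false p := by
    rintro p ⟨h1, h2⟩
    obtain ⟨d, hd, -, hdB⟩ := mem_bends_of_not_mem_eta hZ hY (fun t ht => (hYZ t ht).symm) h1 h2
    rw [mem_sgn hseg] at hdB
    cases d
    · exact hd
    · simp [hsY] at hdB
  have hnsub1 : ¬ eta lam (Y \ {s}) ⊆ eta lam Y := fun h =>
    hne ((maximal_eta hZ).eq_of_subset (isFace_eta hY) h)
  have hnsub2 : ¬ eta lam Y ⊆ eta lam (Y \ {s}) := fun h =>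
    hne ((maximal_eta hY).eq_of_subset (isFace_eta hZ) h).symm
  obtain ⟨p₁, hp1, hp1'⟩ := Set.not_subset.mp hnsub1
  obtain ⟨p₂, hp2, hp2'⟩ := Set.not_subset.mp hnsub2
  refine ⟨p₁, p₂, ?_, ?_, s, ?_⟩
  · refine Set.eq_singleton_iff_unique_mem.mpr ⟨⟨hp1, hp1'⟩, fun q hq => ?_⟩
    refine eq_of_bend hZ hY (fun t ht => (hYZ t ht).symm) hq.1 hp1 (hZ' q hq)
      (hZ' p₁ ⟨hp1, hp1'⟩) ?_
    rw [mem_sgn hseg]; simp [hsY]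
  · refine Set.eq_singleton_iff_unique_mem.mpr ⟨⟨hp2, hp2'⟩, fun q hq => ?_⟩
    refine eq_of_bend hY hZ hYZ hq.1 hp2 (hY' q hq) (hY' p₂ ⟨hp2, hp2'⟩) ?_
    rw [mem_sgn hseg]; simp
  · exact (kissAlong_iff (eta_isPath hZ p₁ hp1).1 (eta_isPath hY p₂ hp2).1).mpr
      ⟨hZ' p₁ ⟨hp1, hp1'⟩, hY' p₂ ⟨hp2, hp2'⟩⟩

/-- Below every facet `η(Y)` and above a smaller one there is a facet that flips to `η(Y)`. -/
theorem exists_flip (hX : IsBiclosed lam X) (hY : IsBiclosed lam Y) (h : down X ⊆ down Y)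
    (hne : down X ≠ down Y) : ∃ Z, IsBiclosed lam Z ∧ down X ⊆ down Z ∧ down Z ⊆ down Y ∧
      down Z ≠ down Y ∧ Flip (eta lam Z) (eta lam Y) := by
  have hDX := isBiclosed_down hX
  have hDY := isBiclosed_down hY
  -- Deleting from Y↓, the bottom of its fiber, necessarily leaves the fiber.
  obtain ⟨s, hsY, hsX, hZ⟩ := exists_isBiclosed_diff hDX hDY h hne
  have hXZ : down X ⊆ down Y \ {s} := fun t ht => ⟨h ht, fun e => hsX (e ▸ ht)⟩
  have hsub : down (down Y \ {s}) ⊆ down Y \ {s} := by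
    rw [down_eq_lo hZ]; exact lo_eta_subset hZ
  have hne' : down (down Y \ {s}) ≠ down Y := fun e => by
    rw [← e] at hsY
    exact (hsub hsY).2 rfl
  refine ⟨down Y \ {s}, hZ, ?_, hsub.trans Set.sdiff_subset, hne', ?_⟩
  · have := lo_eta_mono hDX hZ hXZ
    rwa [eta_down hX, ← down_eq_lo hX, ← down_eq_lo hZ] at this
  · rw [← eta_down hY]
    refine flip_eta_diff_singleton hDY hsY hZ fun e => hne' ?_
    rw [eta_down hY, eta_eq_eta_iff hZ hY] at e
    exact e

/-! ### Codimension one faces and covers -/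

/-- A codimension one face of a facet shares with it its lower or its upper bound. -/
theorem lo_eq_or_hi_eq (hF : Maximal (IsFace lam) F) (hpF : p ∈ F) :
    lo lam (F \ {p}) = lo lam F ∨ hi lam (F \ {p}) = hi lam F := by
  by_contra hcon
  push Not at hcon
  obtain ⟨hlo, hhi⟩ := hcon
  have hC : F \ {p} ⊆ F := Set.sdiff_subset
  have hCp : ∀ q ∈ F \ {p}, IsPath lam q := fun q hq => hF.prop.1 q hq.1
  have hY := isBiclosed_lo hF.prop.1
  have hW := isBiclosed_hi hF.prop.1
  have hηY := eta_lo hF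
  have hηW := eta_hi hF
  have hYW : lo lam F ⊆ hi lam F := hF.prop.lo_subset_hi
  have hmemF : ∀ {Z}, IsBiclosed lam Z → lo lam (F \ {p}) ⊆ Z → Z ⊆ hi lam (F \ {p}) →
      p ∈ eta lam Z → lo lam F ⊆ Z ∧ Z ⊆ hi lam F := by
    intro Z hZ h1 h2 hpZ
    rw [← subset_eta_iff hZ hF.prop.1]
    have := (subset_eta_iff hZ hCp).mpr ⟨h1, h2⟩
    intro q hq
    by_cases hqp : q = p
    · rwa [hqp]
    · exact this ⟨hq, hqp⟩
  -- If both bounds changed, one segment `s` could be deleted from the lower bound and one segment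
  -- `t` added to the upper bound without losing any path of F other than `p`. Then `p` must bend
  -- along `s` and along `t`, in opposite ways.
  obtain ⟨s, hsY, hsC, hZ⟩ := exists_isBiclosed_diff (isBiclosed_lo hCp) hY (lo_mono hC) hlo
  obtain ⟨t, htC, htW, hV⟩ := exists_isBiclosed_insert hW (isBiclosed_hi hCp) (hi_anti hC) hhi.symm
  have hpZ : p ∉ eta lam (lo lam F \ {s}) := fun h => by
    have := (hmemF hZ (fun x hx => ⟨lo_mono hC hx, fun e => hsC (e ▸ hx)⟩)
      (Set.sdiff_subset.trans (hYW.trans (hi_anti hC))) h).1 hsY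
    exact this.2 rfl
  have hpV : p ∉ eta lam (insert t (hi lam F)) := fun h => by
    have := (hmemF hV (((lo_mono hC).trans hYW).trans (Set.subset_insert _ _))
      (Set.insert_subset htC (hi_anti hC)) h).2 (Set.mem_insert _ _)
    exact htW this
  have hYZ : ∀ x, x ≠ s → (x ∈ lo lam F ↔ x ∈ lo lam F \ {s}) := fun x hx => by simp [hx]
  have hWV : ∀ x, x ≠ t → (x ∈ hi lam F ↔ x ∈ insert t (hi lam F)) := fun x hx => by simp [hx]
  have hpY : p ∈ eta lam (lo lam F) := by rwa [hηY]
  have hpW : p ∈ eta lam (hi lam F) := by rwa [hηW]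
  have hsseg : IsSegment lam s := hY.1 hsY
  have htseg : IsSegment lam t := (isBiclosed_hi hCp).1 htC
  obtain ⟨d, hsp, hsd, hsd'⟩ := mem_bends_of_not_mem_eta hY hZ hYZ hpY hpZ
  have hd : d = true := by rw [mem_sgn hsseg] at hsd; exact hsd.mp hsY
  subst hd
  obtain ⟨d, htp, htd, htd'⟩ := mem_bends_of_not_mem_eta hW hV hWV hpW hpV
  have hd : d = false := by
    rw [mem_sgn htseg] at htd
    cases d
    · rfl
    · simp [htW] at htd
  subst hd
  obtain ⟨i, j, hi, hij, hj, -, hdi, hdj, hci, hcj⟩ :=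
    exists_isCut_of_bend hY hZ hYZ hpY hsp hsd'
  obtain ⟨a, b, ha, hab, hb, -, hda, hdb, hca, hcb⟩ :=
    exists_isCut_of_bend hW hV hWV hpW htp htd'
  have hpath := hF.prop.1 p hpF
  have hcompY := ((mem_eta_iff hY).mp hpY).2
  have hcompW := ((mem_eta_iff hW).mp hpW).2
  rw [Bool.not_true] at hdj
  rw [Bool.not_false] at hdb
  -- Both are greatest horizontal edges of `p`: `j` for the lower bound and `a` for the upper one.
  -- If they differ, then for a > j the inclusion of the bounds is violated. For a < j, all
  -- SW-subsegments of the part between them are in the upper bound, which puts this part in the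
  -- lower bound.
  have haj : a = j := by
    by_contra hne
    have h1 : EdgeLt (lo lam F) p a j := (hcj a ⟨ha, by omega⟩ hne).mp hda
    have h2 : EdgeLt (NonKissing.hi lam F) p j a :=
      (hca j ⟨by omega, hj⟩ (Ne.symm hne)).mp hdj
    rcases Nat.lt_or_gt_of_ne hne with hlt | hgt
    · rw [EdgeLt.of_lt hlt] at h1
      apply h1
      have key : sl p a j ∈ cl lam (allBends true (eta lam (NonKissing.hi lam F))) := by
        refine mem_cl_of_subs_subset hW (hpath.track.isSegment ha hlt hj) ?_
        rintro x ⟨c, e, hce, he, rfl, hc1, he1⟩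
        rw [length_sl hj.le] at he he1
        rw [sl_sl (by omega)]
        have hr : dir p (a + e) = false := by
          rcases he.eq_or_lt with h | hlt'
          · rw [h, show a + (j - a) = j by omega]; exact hdj
          · have := he1.resolve_left (by omega)
            rwa [dir_sl (by omega) (by omega)] at this
        have hl : EdgeLt (NonKissing.hi lam F) p (a + e) (a + c) := by
          rcases Nat.eq_zero_or_pos c with rfl | hpos
          · exact (hca (a + e) ⟨by omega, by omega⟩ (by omega)).mp hr
          · have := hc1.resolve_left (by omega)
            rw [dir_sl hpos (by omega)] at this
            exact hcompW _ _ ⟨by omega, by omega⟩ ⟨by omega, by omega⟩ hr this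
        rw [EdgeLt.of_gt (by omega)] at hl
        exact hl
      rw [hηW] at key
      exact key
    · rw [EdgeLt.of_gt hgt] at h1
      rw [EdgeLt.of_lt hgt] at h2
      exact h2 (hYW h1)
  -- Dually for the least vertical edges. The two equalities contradict i < j and a < b.
  have hbi : b = i := by
    by_contra hne
    have h1 : EdgeLt (lo lam F) p i b := by
      rw [← not_edgeLt hne, ← hci b ⟨by omega, hb⟩ hne, hdb]; simp
    have h2 : EdgeLt (NonKissing.hi lam F) p b i := by
      rw [← not_edgeLt (Ne.symm hne), ← hcb i ⟨hi, by omega⟩ (Ne.symm hne), hdi]; simp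
    rcases Nat.lt_or_gt_of_ne hne with hlt | hgt
    · rw [EdgeLt.of_gt hlt] at h1
      rw [EdgeLt.of_lt hlt] at h2
      exact h2 (hYW h1)
    · rw [EdgeLt.of_gt hgt] at h2
      apply h2.2
      have key : sl p i b ∈ cl lam (allBends false (eta lam (lo lam F))) := by
        have hseg := hpath.track.isSegment hi hgt hb
        refine mem_cl_of_subs_subset hY hseg ?_
        intro x hx
        refine ⟨subs_isSegment hseg hx, ?_⟩
        obtain ⟨c, e, hce, he, rfl, hc1, he1⟩ := hx
        rw [length_sl hb.le] at he he1
        rw [sl_sl (by omega)]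
        have hr : dir p (i + e) = true := by
          rcases he.eq_or_lt with h | hlt'
          · rw [h, show i + (b - i) = b by omega]; exact hdb
          · have := he1.resolve_left (by omega)
            rwa [dir_sl (by omega) (by omega)] at this
        have hl : EdgeLt (lo lam F) p (i + c) (i + e) := by
          rcases Nat.eq_zero_or_pos c with rfl | hpos
          · rw [Nat.add_zero, ← not_edgeLt (by omega), ← hci (i + e) ⟨by omega, by omega⟩ (by omega), hr]; simp
          · have := hc1.resolve_left (by omega)
            rw [dir_sl hpos (by omega)] at this
            exact hcompY _ _ ⟨by omega, by omega⟩ ⟨by omega, by omega⟩ this hr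
        rwa [EdgeLt.of_lt (by omega)] at hl
      rw [hηY] at key
      exact key
  omega

/-- The kissing segment is in the lower bound of η(Y) but not in the upper bound of η(X). So the
common face C must take its lower bound from η(X) and its upper bound from η(Y), whence X↓ ⊆ Y↓. If
something lay strictly between, some V there would flip to η(Y); its facet consists of C and one
more path, so it shares a bound with C and coincides with one of the two facets. -/
theorem Flip.down_lt (hX : IsBiclosed lam X) (hY : IsBiclosed lam Y)
    (h : Flip (eta lam X) (eta lam Y)) : down X ⊆ down Y ∧ down X ≠ down Y ∧
      ∀ Z, IsBiclosed lam Z → down X ⊆ down Z → down Z ⊆ down Y → down Z = down X ∨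
        down Z = down Y := by
  have hF := maximal_eta hX
  have hG := maximal_eta hY
  obtain ⟨p₁, p₂, h1, h2, s, hs⟩ := h
  obtain ⟨hp1, hp1'⟩ : p₁ ∈ eta lam X \ eta lam Y := h1 ▸ rfl
  obtain ⟨hp2, hp2'⟩ : p₂ ∈ eta lam Y \ eta lam X := h2 ▸ rfl
  obtain ⟨hs1, hs2⟩ := (kissAlong_iff (eta_isPath hX _ hp1).1 (eta_isPath hY _ hp2).1).mp hs
  have hCF : eta lam X \ {p₁} = eta lam X ∩ eta lam Y := by
    rw [← h1, Set.sdiff_sdiff_right_self]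
  have hCG : eta lam Y \ {p₂} = eta lam X ∩ eta lam Y := by
    rw [← h2, Set.sdiff_sdiff_right_self, Set.inter_comm]
  have hsG : s ∈ lo lam (eta lam Y) := subset_cl ⟨p₂, hp2, hs2⟩
  have hsF : s ∉ hi lam (eta lam X) := fun h => h.2 (subset_cl ⟨p₁, hp1, hs1⟩)
  have hneq : lo lam (eta lam X) ≠ lo lam (eta lam Y) := fun e => by
    rw [← e] at hsG
    exact hsF (hF.prop.lo_subset_hi hsG)
  set C := eta lam X ∩ eta lam Y with hC
  have hloF : lo lam C = lo lam (eta lam X) := by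
    have := lo_eq_or_hi_eq hF hp1
    rw [hCF] at this
    refine this.resolve_right fun e => hsF ?_
    rw [← e]
    exact hi_anti Set.inter_subset_right (hG.prop.lo_subset_hi hsG)
  have hhiG : hi lam C = hi lam (eta lam Y) := by
    have := lo_eq_or_hi_eq hG hp2
    rw [hCG] at this
    exact this.resolve_left fun e => hneq (hloF.symm.trans e)
  have hle : down X ⊆ down Y := by
    rw [down_eq_lo hX, down_eq_lo hY, ← hloF]
    exact lo_mono Set.inter_subset_right
  refine ⟨hle, by rwa [down_eq_lo hX, down_eq_lo hY], fun Z hZ hXZ hZY => ?_⟩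
  by_contra hcon
  push Not at hcon
  obtain ⟨V, hV, hZV, hVY, hVne, q, q', hq, hq', -⟩ := exists_flip hZ hY hZY hcon.2
  have hH := maximal_eta hV
  have hCV : C ⊆ eta lam V := by
    refine (subset_eta_iff hV fun p hp => hF.prop.1 p hp.1).mpr ⟨?_, ?_⟩
    · rw [hloF, ← down_eq_lo hX]
      refine (hXZ.trans hZV).trans ?_
      rw [down_eq_lo hV]; exact lo_eta_subset hV
    · rw [hhiG]
      exact (subset_hi_eta hV).trans (hi_eta_mono_of_down hV hY hVY)
  obtain ⟨hqV, hqY⟩ : q ∈ eta lam V \ eta lam Y := hq ▸ rfl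
  have hCq : eta lam V \ {q} = C := by
    have h3 : eta lam V \ {q} = eta lam V ∩ eta lam Y := by rw [← hq, Set.sdiff_sdiff_right_self]
    rw [h3]
    -- A common path of η(V) and η(Y) outside C could only be `p₂`, but then η(Y) would be contained
    -- in η(V).
    refine Set.Subset.antisymm (fun x hx => ?_) fun x hx => ⟨hCV hx, hx.2⟩
    rw [← hCG]
    refine ⟨hx.2, ?_⟩
    rintro rfl
    have hsub : eta lam Y ⊆ eta lam V := fun y hy => by
      by_cases hyx : y = x
      · exact hyx ▸ hx.1
      · exact hCV (hCG ▸ ⟨hy, hyx⟩)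
    have : q' ∈ eta lam Y \ eta lam V := hq' ▸ rfl
    exact this.2 (hsub this.1)
  have hT := lo_eq_or_hi_eq hH hqV
  rw [hCq] at hT
  rcases hT with e | e
  · rw [hloF, ← down_eq_lo hX, ← down_eq_lo hV] at e
    exact hcon.1 ((hZV.trans e.symm.subset).antisymm hXZ)
  · apply hqY
    rw [hhiG] at e
    rwa [← eta_hi hG, e, eta_hi hH]

/-! ### Reduced facets -/

/-- `F` without its horizontal and vertical paths. -/
def reduce (F : Set (List Vertex)) : Set (List Vertex) := {p ∈ F | ¬ IsHorizontal p ∧ ¬ IsVertical p}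

theorem bends_eq_empty (hp : IsTrack lam p) (h : IsHorizontal p ∨ IsVertical p) (d : Bool) :
    bends d p = ∅ := by
  rw [Set.eq_empty_iff_forall_notMem]
  rintro s ⟨i, j, hi, hij, hj, -, h1, h2⟩
  rcases h with h | h
  · rw [hp.isHorizontal_iff.mp h i ⟨hi, by omega⟩] at h1
    rw [hp.isHorizontal_iff.mp h j ⟨by omega, hj⟩, ← h1] at h2
    simp at h2
  · rw [hp.isVertical_iff.mp h i ⟨hi, by omega⟩] at h1
    rw [hp.isVertical_iff.mp h j ⟨by omega, hj⟩, ← h1] at h2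
    simp at h2

theorem mem_eta_of_straight (hX : IsBiclosed lam X) (hp : IsPath lam p)
    (h : IsHorizontal p ∨ IsVertical p) : p ∈ eta lam X :=
  (mem_eta_iff_bends hX).mpr ⟨hp, fun d => by simp [bends_eq_empty hp.track h d]⟩

theorem eta_subset_of_reduce_subset (hX : IsBiclosed lam X) (hY : IsBiclosed lam Y)
    (h : reduce (eta lam X) ⊆ eta lam Y) : eta lam X ⊆ eta lam Y := by
  intro p hp
  by_cases hs : IsHorizontal p ∨ IsVertical p
  · exact mem_eta_of_straight hY (eta_isPath hX p hp) hs
  · exact h ⟨hp, not_or.mp hs⟩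

theorem reduce_eta_injective (hX : IsBiclosed lam X) (hY : IsBiclosed lam Y)
    (h : reduce (eta lam X) = reduce (eta lam Y)) : eta lam X = eta lam Y :=
  (eta_subset_of_reduce_subset hX hY (h.subset.trans fun _ hp => hp.1)).antisymm
    (eta_subset_of_reduce_subset hY hX (h.symm.subset.trans fun _ hp => hp.1))

theorem isReducedFace_reduce (hF : IsFace lam F) : IsReducedFace lam (reduce F) :=
  ⟨⟨fun p hp => hF.1 p hp.1, fun p hp q hq => hF.2 p hp.1 q hq.1⟩, fun _ hp => hp.2⟩

/-- A larger reduced face G lies in the facet of its lower bound. That facet also contains all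
straight paths, hence all of η(X), hence equals it. -/
theorem maximal_reduce_eta (hX : IsBiclosed lam X) :
    Maximal (IsReducedFace lam) (reduce (eta lam X)) := by
  refine ⟨isReducedFace_reduce (isFace_eta hX), fun G hG hsub q hq => ?_⟩
  have hlo := isBiclosed_lo hG.1.1
  have hGlo := hG.1.subset_eta_lo
  have h : eta lam X = eta lam (lo lam G) := (maximal_eta hX).eq_of_subset (isFace_eta hlo)
    (eta_subset_of_reduce_subset hX hlo (hsub.trans hGlo))
  exact ⟨h ▸ hGlo hq, hG.2 q hq⟩

theorem exists_reduce_eta_eq (hF : Maximal (IsReducedFace lam) F) :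
    ∃ X, IsBiclosed lam X ∧ reduce (eta lam X) = F := by
  have hlo := isBiclosed_lo hF.prop.1.1
  refine ⟨_, hlo, (hF.eq_of_subset (isReducedFace_reduce (isFace_eta hlo)) fun p hp => ?_).symm⟩
  exact ⟨hF.prop.1.subset_eta_lo hp, hF.prop.2 p hp⟩

theorem reduce_diff_reduce (hX : IsBiclosed lam X) (hY : IsBiclosed lam Y) :
    reduce (eta lam X) \ reduce (eta lam Y) = eta lam X \ eta lam Y := by
  ext p
  constructor
  · rintro ⟨⟨h1, h2⟩, h3⟩
    exact ⟨h1, fun h => h3 ⟨h, h2⟩⟩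
  · rintro ⟨h1, h2⟩
    refine ⟨⟨h1, ?_⟩, fun h => h2 h.1⟩
    rw [← not_or]
    exact fun h => h2 (mem_eta_of_straight hY (eta_isPath hX p h1) h)

theorem flip_reduce_iff (hX : IsBiclosed lam X) (hY : IsBiclosed lam Y) :
    Flip (reduce (eta lam X)) (reduce (eta lam Y)) ↔ Flip (eta lam X) (eta lam Y) := by
  unfold Flip
  rw [reduce_diff_reduce hX hY, reduce_diff_reduce hY hX]

end Flips

/-! ### The Grid-Tamari order -/

/-- The element of the Grid-Tamari order given by a biclosed set. -/
def toGridTamari {lam : Finset Vertex} (X : Bic lam) : GridTamari lam :=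
  ⟨reduce (eta lam X.1), maximal_reduce_eta X.2⟩

theorem toGridTamari_surjective {lam : Finset Vertex} :
    Function.Surjective (toGridTamari (lam := lam)) := by
  rintro ⟨F, hF⟩
  obtain ⟨X, hX, rfl⟩ := exists_reduce_eta_eq hF
  exact ⟨⟨X, hX⟩, rfl⟩

theorem toGridTamari_eq_iff {lam : Finset Vertex} {X Y : Bic lam} :
    toGridTamari X = toGridTamari Y ↔ down X.1 = down Y.1 := by
  rw [← eta_eq_eta_iff X.2 Y.2]
  constructor
  · intro h
    exact reduce_eta_injective X.2 Y.2 (congrArg Subtype.val h)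
  · intro h
    exact Subtype.ext (congrArg reduce h)

theorem flip_toGridTamari_iff {lam : Finset Vertex} {X Y : Bic lam} :
    Flip (toGridTamari X).1 (toGridTamari Y).1 ↔ Flip (eta lam X.1) (eta lam Y.1) :=
  flip_reduce_iff X.2 Y.2

/-- Each flip enlarges X↓; conversely one flips down from Y while staying above X, which ends
because Y↓ is finite. -/
theorem gtLe_toGridTamari_iff {lam : Finset Vertex} {X Y : Bic lam} :
    GTLe (toGridTamari X) (toGridTamari Y) ↔ down X.1 ⊆ down Y.1 := by
  constructor
  · intro h
    have : ∀ F G : GridTamari lam, GTLe F G → ∀ X Y : Bic lam, toGridTamari X = F →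
        toGridTamari Y = G → down X.1 ⊆ down Y.1 := by
      intro F G hFG
      induction hFG with
      | refl => intro X Y h1 h2; exact (toGridTamari_eq_iff.mp (h1.trans h2.symm)).subset
      | @tail G H _ hGH ih =>
        rintro X Y hX rfl
        obtain ⟨Z, rfl⟩ := toGridTamari_surjective G
        exact (ih X Z hX rfl).trans (Flip.down_lt Z.2 Y.2 (flip_toGridTamari_iff.mp hGH)).1
    exact this _ _ h X Y rfl rfl
  · intro h
    induction hn : (down Y.1).ncard using Nat.strong_induction_on generalizing Y with
    | _ n ih =>
      subst hn
      by_cases he : down X.1 = down Y.1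
      · rw [toGridTamari_eq_iff.mpr he]; exact Relation.ReflTransGen.refl
      · obtain ⟨Z, hZ, hXZ, hZY, hne, hflip⟩ := exists_flip X.2 Y.2 h he
        have hlt : (down Z).ncard < (down Y.1).ncard :=
          Set.ncard_lt_ncard (hZY.ssubset_of_ne hne)
            ((finite_segments lam).subset (isBiclosed_down Y.2).1)
        exact (ih _ hlt (Y := ⟨Z, hZ⟩) hXZ rfl).tail
          (flip_toGridTamari_iff (X := ⟨Z, hZ⟩).mpr hflip)

/-- The Grid-Tamari order is the quotient of the lattice of biclosed sets. -/
noncomputable def quotientEquiv (lam : Finset Vertex) :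
    letI := bicLattice lam
    LatticeQuotient (downCon lam) ≃ GridTamari lam :=
  letI := bicLattice lam
  Equiv.ofBijective
    (Quotient.lift toGridTamari fun _ _ h => toGridTamari_eq_iff.mpr h)
    ⟨by
      rintro ⟨X⟩ ⟨Y⟩ h
      exact Quotient.sound (s := (downCon lam).toSetoid) (toGridTamari_eq_iff.mp h),
    fun F => by
      obtain ⟨X, rfl⟩ := toGridTamari_surjective F
      exact ⟨cls _ X, rfl⟩⟩

theorem covBy_cls_iff {lam : Finset Vertex} (X Y : Bic lam) :
    letI := bicLattice lam
    cls (downCon lam) X ⋖ cls (downCon lam) Y ↔ Flip (eta lam X.1) (eta lam Y.1) := by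
  let := bicLattice lam
  constructor
  · intro h
    have h1 := (cls_le_cls_iff X Y).mp h.le
    have h2 : down X.1 ≠ down Y.1 := fun e => h.lt.not_ge ((cls_le_cls_iff Y X).mpr e.symm.subset)
    obtain ⟨Z, hZ, hXZ, hZY, hne, hflip⟩ := exists_flip X.2 Y.2 h1 h2
    have h3 : cls (downCon lam) X ≤ cls (downCon lam) ⟨Z, hZ⟩ := (cls_le_cls_iff X ⟨Z, hZ⟩).mpr hXZ
    have h4 : cls (downCon lam) ⟨Z, hZ⟩ < cls (downCon lam) Y :=
      lt_of_le_not_ge ((cls_le_cls_iff ⟨Z, hZ⟩ Y).mpr hZY)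
        fun h => hne (hZY.antisymm ((cls_le_cls_iff Y ⟨Z, hZ⟩).mp h))
    have h5 : down Z ⊆ down X.1 := by
      by_contra hc
      exact h.2 (lt_of_le_not_ge h3 fun h => hc ((cls_le_cls_iff ⟨Z, hZ⟩ X).mp h)) h4
    rwa [(eta_eq_eta_iff X.2 hZ).mpr (hXZ.antisymm h5)]
  · intro h
    obtain ⟨h1, h2, h3⟩ := Flip.down_lt X.2 Y.2 h
    refine ⟨lt_of_le_not_ge ((cls_le_cls_iff X Y).mpr h1)
      fun h => h2 (h1.antisymm ((cls_le_cls_iff Y X).mp h)), ?_⟩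
    rintro ⟨Z⟩ hXZ hZY
    have hXZ' : cls (downCon lam) X < cls (downCon lam) Z := hXZ
    have hZY' : cls (downCon lam) Z < cls (downCon lam) Y := hZY
    rcases h3 Z.1 Z.2 ((cls_le_cls_iff X Z).mp hXZ'.le) ((cls_le_cls_iff Z Y).mp hZY'.le) with e | e
    · exact hXZ'.not_ge ((cls_le_cls_iff Z X).mpr e.subset)
    · exact hZY'.not_ge ((cls_le_cls_iff Y Z).mpr e.symm.subset)

end NonKissing

/-! ### The main theorem -/

open NonKissing
theorem corollary7 (lam : Finset (ℤ × ℤ)) :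
    (∀ (X : Bic lam) (u : ℤ × ℤ), IsVerticalEdge lam u → ∃! p, IsEtaPath lam X.1 u p) ∧
    ∃ (_ : Lattice (Bic lam)) (Θ : LatticeCon (Bic lam)) (_ : PartialOrder (GridTamari lam))
      (η : Bic lam → Facet lam) (f : LatticeQuotient Θ ≃o GridTamari lam),
      -- `Bic(S)` is ordered by inclusion, `Θ` is `X↓ = Y↓`, and the Grid-Tamari order is the
      -- transitive closure of the oriented flips
      (∀ X Y : Bic lam, X ≤ Y ↔ X.1 ⊆ Y.1) ∧
      (∀ X Y : Bic lam, Θ.r X Y ↔ down X.1 = down Y.1) ∧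
      (∀ F G : GridTamari lam, F ≤ G ↔ GTLe F G) ∧
      -- `η` maps onto the facets, and its fibers are the classes of `Θ`
      (∀ X : Bic lam, (η X).1 = eta lam X.1) ∧
      Function.Surjective η ∧
      (∀ X Y : Bic lam, η X = η Y ↔ Θ.r X Y) ∧
      -- the isomorphism is induced by `η`, up to removing the horizontal and vertical paths
      (∀ X : Bic lam, (f (cls Θ X)).1 =
        {p ∈ (η X).1 | ¬ IsHorizontal p ∧ ¬ IsVertical p}) ∧
      -- the covering relations of the quotient are the oriented flips
      (∀ a b : LatticeQuotient Θ, a ⋖ b ↔ Flip (f a).1 (f b).1) := by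
  refine ⟨fun X u hu => existsUnique_isEtaPath X.1 hu, ?_⟩
  let := bicLattice lam
  let e := quotientEquiv lam
  -- The order is transported from the quotient, which makes it antisymmetric at once; it is then
  -- identified with the closure of the flips.
  let : PartialOrder (GridTamari lam) := PartialOrder.lift e.symm e.symm.injective
  have he : ∀ X, e (cls (downCon lam) X) = toGridTamari X := fun _ => rfl
  have hle : ∀ X Y : Bic lam, toGridTamari X ≤ toGridTamari Y ↔ down X.1 ⊆ down Y.1 := by
    intro X Y
    rw [← cls_le_cls_iff, ← he, ← he]
    change e.symm (e _) ≤ e.symm (e _) ↔ _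
    rw [e.symm_apply_apply, e.symm_apply_apply]
  refine ⟨bicLattice lam, downCon lam, inferInstance,
    fun X => ⟨eta lam X.1, maximal_eta X.2⟩, ⟨e, ?_⟩, fun _ _ => Iff.rfl, fun _ _ => Iff.rfl, ?_,
    fun _ => rfl, ?_, ?_, fun _ => rfl, ?_⟩
  · rintro ⟨X⟩ ⟨Y⟩
    exact (hle X Y).trans (cls_le_cls_iff X Y).symm
  · intro F G
    obtain ⟨X, rfl⟩ := toGridTamari_surjective F
    obtain ⟨Y, rfl⟩ := toGridTamari_surjective G
    rw [hle, gtLe_toGridTamari_iff]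
  · rintro ⟨F, hF⟩
    exact ⟨⟨lo lam F, isBiclosed_lo hF.prop.1⟩, Subtype.ext (eta_lo hF)⟩
  · intro X Y
    exact Subtype.ext_iff.trans (eta_eq_eta_iff X.2 Y.2)
  · rintro ⟨X⟩ ⟨Y⟩
    exact (covBy_cls_iff X Y).trans flip_toGridTamari_iff.symm
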